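/- Notation. Put $\omega_0^s=1$, $\omega_k^s=k^s$ for $k\ge1$; $\Omega^s=\{x=(x_k)_{k\ge0}\subset\mathbb R:\ \|x\|_s=\sup_k|x_k|\omega_k^s<\infty\}$; $B_0(r)=\{x\in\Omega^s:\|x\|_s\le r\}$; $(x*y)_k=\sum_{k_1+k_2=k,\ k_i\in\mathbb Z}x_{|k_1|}y_{|k_2|}$. For a sequence $x$ and a fixed $m$ write $x_F=(x_0,\dots,x_{m-1})$, $x_I=(x_m,x_{m+1},\dots)$. Absolute values and inequalities of vectors and matrices are componentwise. Assumptions. Let $s\ge2$, $s_L>0$, $0<C_1\le C_2$, $0<\delta<\tfrac12$, $k_0\ge0$, and let $(\lambda_k),(\mu_k),(\beta_k)$ be real sequences such that $|\lambda_k|,|\mu_k|,|\beta_k|\le C_2\omega_k^{s_L}$ for all $k\ge0$, and $|\mu_k|\ge C_1\omega_k^{s_L}$, $|\lambda_k/\mu_k|\le\delta$, $|\beta_k/\mu_k|\le\delta$ for all $k\ge k_0$. Let $\mathcal L_0(x)=\mu_0x_0+\beta_0x_1$, $\mathcal L_k(x)=\lambda_kx_{k-1}+\mu_kx_k+\beta_kx_{k+1}$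 $(k\ge1)$, let $\sigma\in\mathbb R$, $g\in\Omega^s$, and $$f:\Omega^s\to\Omega^{s-s_L},\qquad f(x)=\mathcal L(x)+\sigma\,(x*x)+g .$$ Let $m\ge\max(6,k_0)$ and $\bar x=(\bar x_0,\dots,\bar x_{m-1},0,0,\dots)$; let $f^{(m)}:\mathbb R^m\to\mathbb R^m$, $f^{(m)}(v)=\big(f(v,0,0,\dots)\big)_F$, and $D=Df^{(m)}(\bar x)$. Let $L\ge1$ be an integer and $A_m$ any real $m\times m$ matrix (in practice, a numerical inverse of a finite block); its last column, last row and south-east entry are $(A_m)_{c_{m-1}}$, $(A_m)_{r_{m-1}}$, $(A_m)_{m-1,m-1}$. The operators. $(A^\dagger z)_F=Dz_F+(0,\dots,0,\beta_{m-1}z_m)^T$ and $(A^\dagger z)_k=\mathcal L_k(z)$ for $k\ge m$. With $a_n=\lambda_{m+n-1}$, $b_n=\mu_{m+n-1}$, $c_n=\beta_{m+n-1}$, $\delta_0=1$, $\delta_1=b_1$, $\delta_n=b_n\delta_{n-1}-a_nc_{n-1}\delta_{n-2}$, put for $k\ge0$ $$(L_I^{-1}y)_k=y_k+\sum_{l=1}^k(-1)^la_{k-l+2}\cdots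 a_{k+1}\frac{\delta_{k-l}}{\delta_k}y_{k-l},\qquad (U_I^{-1}z)_k=\sum_{l=0}^\infty(-1)^l\frac{\delta_k}{\delta_{k+l+1}}c_{k+1}\cdots c_{k+l}\,z_{k+l},$$ $w_I=U_I^{-1}L_I^{-1}(1,0,0,\dots)^T$, and, with $u=U_I^{-1}L_I^{-1}v_I$, $$(Av)_F=A_mv_F-\beta_{m-1}u_0(A_m)_{c_{m-1}},\qquad (Av)_I=-\lambda_m\big((A_m)_{r_{m-1}}v_F\big)w_I+u+\beta_{m-1}\lambda_m(A_m)_{m-1,m-1}u_0\,w_I .$$ Constants. $\gamma=\frac12+\sqrt{\frac14-\delta^2}$, $\theta=\delta/\gamma$, $\eta=\frac1{\gamma(1-\theta^2)}$, $$\chi=\theta^{\frac M2}\tfrac M2\Big(\tfrac{m+M}m\Big)^{s+s_L}+\theta^{\sqrt M}\tfrac M2\,2^{s+s_L}+\tfrac1{1-\theta}\Big(\tfrac{m+M}{m+M-\sqrt M-1}\Big)^{s+s_L}.$$ With $\Sigma=2\sum_{l=1}^L l^{-s}+\frac2{(s-1)L^{s-1}}$, put $\alpha_0=1+\Sigma$,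 $\alpha_k=2+\Sigma+\sum_{l=1}^{k-1}\frac{k^s}{l^s(k-l)^s}$ for $1\le k<m$, and $$\alpha_m=2+\Sigma+2\Big(\tfrac m{m-1}\Big)^s+\Big(\tfrac{4\ln(m-2)}m+\tfrac{\pi^2-6}3\Big)\Big(\tfrac2m+\tfrac12\Big)^{s-2}.$$ Put $C^1_0=0$, $C^1_k=2|\sigma|\sum_{l=m-k}^{m-1}|\bar x_l|/\omega^s_{k+l}$ for $1\le k\le m-1$, $\kappa^1=2|\sigma|\alpha_m\|\bar x\|_s$; and $C^2_k=2|\sigma|\alpha_k/\omega_k^s$ for $0\le k\le m-1$, $\kappa^2=2|\sigma|\alpha_m$. The vectors $D^1(\bar x)$ and $D^2$. For $i=1,2$ let $$D^i_F=|A_m|C^i_F+\frac{|\beta_{m-1}|\,\eta\,\kappa^i}{C_1(1-\theta)\omega_m^{s+s_L}}|A_m|_{c_{m-1}},\qquad P^i=\Big(|A_m|_{r_{m-1}}C^i_F+\frac{|\beta_{m-1}||A_m|_{m-1,m-1}\eta\,\kappa^i}{C_1(1-\theta)\omega_m^{s+s_L}}\Big)\eta\frac{|\lambda_m|}{|\mu_m|},$$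 $$D^i_{m+k}=P^i\theta^k+\frac{\eta\,\kappa^i}{C_1\omega_{m+k}^{s+s_L}}\Big(\sum_{l=0}^k\theta^{k-l}\Big(\tfrac{m+k}{m+l}\Big)^{s+s_L}+\tfrac\theta{1-\theta}\Big)\quad(0\le k<M),$$ $$D^i_{m+M}=P^i\theta^M+\frac{\eta\,\kappa^i}{C_1\omega_{m+M}^{s+s_L}}\Big(\chi+\tfrac\theta{1-\theta}\Big),\qquad D^i_{m+k}=D^i_{m+M}\frac{\omega_{m+M}^s}{\omega_{m+k}^s}\quad(k>M).$$ Proposition. Let $M$ be an integer with $$M\ge\max\Big(\tfrac{-m\ln\sqrt\theta-s-s_L-1-\sqrt{(m\ln\sqrt\theta+s+s_L+1)^2-4m\ln\sqrt\theta}}{2\ln\sqrt\theta},\ \tfrac4{(\ln\theta)^2},\ m\Big)\quad\text{and}\quad M\ge\max\Big(\tfrac{-s}{\ln\theta}-m,\ m-2\Big),$$ and let $Z^2(r)=D^1(\bar x)\,r+D^2r^2$. Then for all $y,z\in B_0(r)$ the derivatives $Df^{(m)}(\bar x)$ and $Df(\bar x+y)$ exist, the series defining $w_I$ and $A\big(Df(\bar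 x+y)-A^\dagger\big)z$ converge, and $$\Big|A\big(Df(\bar x+y)-A^\dagger\big)z\Big|\le Z^2(r)\quad\text{componentwise.}$$ -/

import Mathlib

noncomputable section

namespace TridiagNewton

/-- The weights `ω_k^s`: `1` for `k = 0` and `k ^ s` for `k ≥ 1`. -/
def weight (s : ℝ) (k : ℕ) : ℝ := if k = 0 then 1 else (k : ℝ) ^ s

theorem weight_pos (s : ℝ) (k : ℕ) : 0 < weight s k := by
  unfold weight
  split_ifs with h
  · exact one_pos
  · exact Real.rpow_pos_of_pos (by exact_mod_cast Nat.pos_of_ne_zero h) s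

theorem weight_eq_max (s : ℝ) (k : ℕ) : weight s k = (max (k : ℝ) 1) ^ s := by
  unfold weight
  split_ifs with h
  · simp [h]
  · have : (1 : ℝ) ≤ k := by exact_mod_cast Nat.pos_of_ne_zero h
    rw [max_eq_left this]

theorem weight_mul (s t : ℝ) (k : ℕ) : weight s k * weight t k = weight (s + t) k := by
  rw [weight_eq_max, weight_eq_max, weight_eq_max, Real.rpow_add]
  exact lt_of_lt_of_le one_pos (le_max_right _ _)

theorem weight_mono {s t : ℝ} (h : s ≤ t) (k : ℕ) : weight s k ≤ weight t k := by
  rw [weight_eq_max, weight_eq_max]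
  exact Real.rpow_le_rpow_of_exponent_le (le_max_right _ _) h

/-- The sequences `x` for which `|x_k| ω_k^s` is bounded. -/
def OmegaSub (s : ℝ) : Submodule ℝ (ℕ → ℝ) where
  carrier := {x | BddAbove (Set.range fun k => |x k| * weight s k)}
  zero_mem' := by
    refine ⟨0, ?_⟩
    rintro _ ⟨k, rfl⟩
    simp
  add_mem' := by
    rintro x y ⟨a, ha⟩ ⟨b, hb⟩
    refine ⟨a + b, ?_⟩
    rintro _ ⟨k, rfl⟩
    have h1 := ha ⟨k, rfl⟩
    have h2 := hb ⟨k, rfl⟩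
    have h3 := mul_le_mul_of_nonneg_right (abs_add_le (x k) (y k)) (weight_pos s k).le
    simp only [Pi.add_apply] at *
    linarith
  smul_mem' := by
    rintro c x ⟨a, ha⟩
    refine ⟨|c| * a, ?_⟩
    rintro _ ⟨k, rfl⟩
    have h1 := mul_le_mul_of_nonneg_left (ha ⟨k, rfl⟩) (abs_nonneg c)
    simp only [Pi.smul_apply, smul_eq_mul, abs_mul] at *
    linarith

/-- The space `Ω^s`; a type of its own, so that it carries the topology of its norm and not the
topology of componentwise convergence. -/
def Omega (s : ℝ) : Type := OmegaSub s

namespace Omega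

variable {s : ℝ}

instance : AddCommGroup (Omega s) := inferInstanceAs (AddCommGroup (OmegaSub s))

instance : Module ℝ (Omega s) := inferInstanceAs (Module ℝ (OmegaSub s))

/-- The underlying sequence. -/
def seq (x : Omega s) : ℕ → ℝ := Subtype.val (p := fun x => x ∈ OmegaSub s) x

/-- The element of `Ω^s` given by a sequence. -/
def mk (x : ℕ → ℝ) (hx : x ∈ OmegaSub s) : Omega s := Subtype.mk (p := fun x => x ∈ OmegaSub s) x hx

instance : CoeFun (Omega s) (fun _ => ℕ → ℝ) := ⟨seq⟩

theorem seq_mem (x : Omega s) : x.seq ∈ OmegaSub s := Subtype.prop (p := fun x => x ∈ OmegaSub s) x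

theorem ext_seq {x y : Omega s} (h : ∀ k, x k = y k) : x = y := Subtype.ext (funext h)

theorem seq_mk (x : ℕ → ℝ) (hx : x ∈ OmegaSub s) : (mk x hx).seq = x := rfl

theorem seq_zero (k : ℕ) : (0 : Omega s) k = 0 := rfl

theorem seq_add (x y : Omega s) (k : ℕ) : (x + y) k = x k + y k := rfl

theorem seq_smul (c : ℝ) (x : Omega s) (k : ℕ) : (c • x) k = c * x k := rfl

/-- `‖x‖_s = sup_k |x_k| ω_k^s`. -/
instance : Norm (Omega s) := ⟨fun x => ⨆ k, |x k| * weight s k⟩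

theorem norm_def (x : Omega s) : ‖x‖ = ⨆ k, |x k| * weight s k := rfl

theorem bddAbove (x : Omega s) : BddAbove (Set.range fun k => |x k| * weight s k) := seq_mem x

theorem le_norm (x : Omega s) (k : ℕ) : |x k| * weight s k ≤ ‖x‖ :=
  le_ciSup (bddAbove x) k

theorem core : NormedSpace.Core ℝ (Omega s) where
  norm_nonneg x := Real.iSup_nonneg fun k => mul_nonneg (abs_nonneg _) (weight_pos s k).le
  norm_smul c x := by
    have h : ∀ k, |(c • x) k| * weight s k = |c| * (|x k| * weight s k) := fun k => by
      rw [seq_smul, abs_mul, mul_assoc]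
    rw [norm_def, norm_def, iSup_congr h, ← Real.mul_iSup_of_nonneg (abs_nonneg c), Real.norm_eq_abs]
  norm_triangle x y := by
    refine ciSup_le fun k => ?_
    have h3 := mul_le_mul_of_nonneg_right (abs_add_le (x k) (y k)) (weight_pos s k).le
    have h1 := le_norm x k
    have h2 := le_norm y k
    rw [seq_add]
    linarith
  norm_eq_zero_iff x := by
    constructor
    · intro h
      refine ext_seq fun k => ?_
      have h1 := le_norm x k
      rw [h] at h1
      have h2 := weight_pos s k
      have h3 : |x k| ≤ 0 := by
        by_contra h4
        have := mul_pos (not_le.1 h4) h2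
        linarith
      exact abs_nonpos_iff.1 h3
    · rintro rfl
      have h : ∀ k, |(0 : Omega s) k| * weight s k = 0 := fun k => by
        rw [seq_zero, abs_zero, zero_mul]
      rw [norm_def, iSup_congr h]
      simp

instance : NormedAddCommGroup (Omega s) := NormedAddCommGroup.ofCore core

instance : NormedSpace ℝ (Omega s) := NormedSpace.ofCore core

end Omega

/-- The vector `v ∈ ℝ^m` seen as the sequence `(v_0, …, v_{m-1}, 0, 0, …)`. -/
def extendZero {m : ℕ} (v : Fin m → ℝ) (k : ℕ) : ℝ := if h : k < m then v ⟨k, h⟩ else 0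

theorem extendZero_mem (s : ℝ) {m : ℕ} (v : Fin m → ℝ) : extendZero v ∈ OmegaSub s := by
  refine ⟨∑ i : Fin m, |v i| * weight s i, ?_⟩
  have h0 : ∀ i : Fin m, 0 ≤ |v i| * weight s i :=
    fun i => mul_nonneg (abs_nonneg _) (weight_pos s i).le
  rintro _ ⟨k, rfl⟩
  by_cases h : k < m
  · have := Finset.single_le_sum (fun i _ => h0 i) (Finset.mem_univ (⟨k, h⟩ : Fin m))
    simpa [extendZero, h] using this
  · simpa [extendZero, h] using Finset.sum_nonneg fun i _ => h0 i

/-- `ℝ^m` inside `Ω^s`. -/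
def embed (s : ℝ) {m : ℕ} (v : Fin m → ℝ) : Omega s := Omega.mk (extendZero v) (extendZero_mem s v)

/-- The tridiagonal operator `λ_k x_{k-1} + μ_k x_k + β_k x_{k+1}` (without the first term if
`k = 0`). -/
def tridiag (lam mu bet x : ℕ → ℝ) : ℕ → ℝ
  | 0 => mu 0 * x 0 + bet 0 * x 1
  | k + 1 => lam (k + 1) * x k + mu (k + 1) * x (k + 1) + bet (k + 1) * x (k + 2)

/-- The growth and dominance assumptions on the tridiagonal operator. -/
structure TridiagAssumptions (lam mu bet : ℕ → ℝ) (sL C₁ C₂ δ : ℝ) (k₀ : ℕ) : Prop where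
  sL_pos : 0 < sL
  C₁_pos : 0 < C₁
  C₁_le_C₂ : C₁ ≤ C₂
  δ_pos : 0 < δ
  δ_lt_half : δ < 1 / 2
  lam_le : ∀ k, |lam k / weight sL k| ≤ C₂
  mu_le : ∀ k, |mu k / weight sL k| ≤ C₂
  bet_le : ∀ k, |bet k / weight sL k| ≤ C₂
  le_mu : ∀ k, k₀ ≤ k → C₁ ≤ |mu k / weight sL k|
  lam_div_mu : ∀ k, k₀ ≤ k → |lam k / mu k| ≤ δ
  bet_div_mu : ∀ k, k₀ ≤ k → |bet k / mu k| ≤ δ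

/-- The discrete convolution of the even extensions of `x` and `y` to `ℤ`. -/
def conv (x y : ℕ → ℝ) (k : ℕ) : ℝ := ∑' j : ℤ, x j.natAbs * y ((k : ℤ) - j).natAbs

theorem weight_succ_le {s : ℝ} (hs : 0 ≤ s) (k : ℕ) : weight s (k + 1) ≤ 2 ^ s * weight s k := by
  rw [weight_eq_max, weight_eq_max, ← Real.mul_rpow (by norm_num) (by positivity)]
  refine Real.rpow_le_rpow (by positivity) ?_ hs
  have h1 := le_max_left (k : ℝ) 1
  have h2 := le_max_right (k : ℝ) 1
  refine max_le ?_ ?_ <;> push_cast <;> linarith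

theorem weight_le_succ {s : ℝ} (hs : 0 ≤ s) (k : ℕ) : weight s k ≤ weight s (k + 1) := by
  rw [weight_eq_max, weight_eq_max]
  refine Real.rpow_le_rpow (by positivity) ?_ hs
  exact max_le_max (by push_cast; linarith) le_rfl

theorem OmegaSub_anti {s t : ℝ} (h : t ≤ s) {x : ℕ → ℝ} (hx : x ∈ OmegaSub s) :
    x ∈ OmegaSub t := by
  obtain ⟨a, ha⟩ := hx
  refine ⟨a, ?_⟩
  rintro _ ⟨k, rfl⟩
  exact (mul_le_mul_of_nonneg_left (weight_mono h k) (abs_nonneg _)).trans (ha ⟨k, rfl⟩)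

theorem tridiag_mem {lam mu bet : ℕ → ℝ} {sL C₁ C₂ δ : ℝ} {k₀ : ℕ}
    (hT : TridiagAssumptions lam mu bet sL C₁ C₂ δ k₀) {s : ℝ} (hs : 0 ≤ s) {x : ℕ → ℝ}
    (hx : x ∈ OmegaSub s) : tridiag lam mu bet x ∈ OmegaSub (s - sL) := by
  obtain ⟨a, ha⟩ := hx
  have ha' : ∀ k, |x k| * weight s k ≤ a := fun k => ha ⟨k, rfl⟩
  have hC : 0 ≤ C₂ := hT.C₁_pos.le.trans hT.C₁_le_C₂
  have ha0 : 0 ≤ a := (mul_nonneg (abs_nonneg _) (weight_pos s 0).le).trans (ha' 0)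
  have h2 : (1 : ℝ) ≤ 2 ^ s := Real.one_le_rpow (by norm_num) hs
  have key : ∀ (c : ℝ) (j k : ℕ), |c / weight sL k| ≤ C₂ → weight s k ≤ 2 ^ s * weight s j →
      |c * x j| * weight (s - sL) k ≤ C₂ * (2 ^ s * a) := by
    intro c j k hc hjk
    have hw := weight_pos sL k
    rw [abs_div, abs_of_pos hw, div_le_iff₀ hw] at hc
    have e : weight sL k * weight (s - sL) k = weight s k := by rw [weight_mul]; congr 1; ring
    calc |c * x j| * weight (s - sL) k = |c| * (|x j| * weight (s - sL) k) := by
          rw [abs_mul]; ring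
      _ ≤ (C₂ * weight sL k) * (|x j| * weight (s - sL) k) :=
          mul_le_mul_of_nonneg_right hc (mul_nonneg (abs_nonneg _) (weight_pos _ _).le)
      _ = C₂ * (|x j| * weight s k) := by rw [← e]; ring
      _ ≤ C₂ * (|x j| * (2 ^ s * weight s j)) := by gcongr
      _ = C₂ * (2 ^ s * (|x j| * weight s j)) := by ring
      _ ≤ C₂ * (2 ^ s * a) := by gcongr; exact ha' j
  have self : ∀ k, weight s k ≤ 2 ^ s * weight s k := fun k =>
    le_mul_of_one_le_left (weight_pos s k).le h2
  have up : ∀ k, weight s k ≤ 2 ^ s * weight s (k + 1) := fun k =>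
    (weight_le_succ hs k).trans (self (k + 1))
  have hpos : 0 ≤ C₂ * (2 ^ s * a) := by positivity
  refine ⟨3 * (C₂ * (2 ^ s * a)), ?_⟩
  rintro _ ⟨k, rfl⟩
  rcases k with _ | k
  · have i1 := key (mu 0) 0 0 (hT.mu_le 0) (self 0)
    have i2 := key (bet 0) 1 0 (hT.bet_le 0) (up 0)
    have i3 := mul_le_mul_of_nonneg_right (abs_add_le (mu 0 * x 0) (bet 0 * x 1))
      (weight_pos (s - sL) 0).le
    change |mu 0 * x 0 + bet 0 * x 1| * weight (s - sL) 0 ≤ _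
    linarith
  · have i1 := key (mu (k + 1)) (k + 1) (k + 1) (hT.mu_le _) (self _)
    have i2 := key (bet (k + 1)) (k + 2) (k + 1) (hT.bet_le _) (up _)
    have i0 := key (lam (k + 1)) k (k + 1) (hT.lam_le _) (weight_succ_le hs k)
    have i3 := mul_le_mul_of_nonneg_right
      (abs_add_three (lam (k + 1) * x k) (mu (k + 1) * x (k + 1)) (bet (k + 1) * x (k + 2)))
      (weight_pos (s - sL) (k + 1)).le
    change |lam (k + 1) * x k + mu (k + 1) * x (k + 1) + bet (k + 1) * x (k + 2)| *
      weight (s - sL) (k + 1) ≤ _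
    linarith

theorem summable_inv_weight {s : ℝ} (hs : 1 < s) :
    Summable fun j : ℤ => (weight s j.natAbs)⁻¹ := by
  have h : Summable fun n : ℕ => (weight s n)⁻¹ := by
    rw [← summable_nat_add_iff 1]
    have h1 := (summable_nat_add_iff 1).2 (Real.summable_nat_rpow_inv.2 hs)
    refine h1.congr fun n => ?_
    simp [weight]
  refine Summable.of_nat_of_neg ?_ ?_
  · simpa using h
  · simpa using h

theorem weight_le_add {s : ℝ} (hs : 0 ≤ s) {k p q : ℕ} (h : k ≤ p + q) :
    weight s k ≤ 2 ^ s * (weight s p + weight s q) := by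
  wlog hpq : q ≤ p generalizing p q
  · rw [add_comm (weight s p)]
    exact this (by omega) (by omega)
  have h2 : (k : ℝ) ≤ p + q := by exact_mod_cast h
  have h3 : (q : ℝ) ≤ p := by exact_mod_cast hpq
  have h4 := le_max_left (p : ℝ) 1
  have h5 := le_max_right (p : ℝ) 1
  have : weight s k ≤ 2 ^ s * weight s p := by
    rw [weight_eq_max, weight_eq_max, ← Real.mul_rpow (by norm_num) (by positivity)]
    exact Real.rpow_le_rpow (by positivity) (max_le (by linarith) (by linarith)) hs
  refine this.trans (mul_le_mul_of_nonneg_left ?_ (by positivity))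
  linarith [weight_pos s q]

theorem conv_term_le {s a b : ℝ} (hs : 0 ≤ s) {x y : ℕ → ℝ} (hx : ∀ k, |x k| * weight s k ≤ a)
    (hy : ∀ k, |y k| * weight s k ≤ b) {k p q : ℕ} (h : k ≤ p + q) :
    |x p * y q * weight s k| ≤ a * b * (2 ^ s * ((weight s p)⁻¹ + (weight s q)⁻¹)) := by
  have hp := weight_pos s p
  have hq := weight_pos s q
  have ha : 0 ≤ a := (mul_nonneg (abs_nonneg _) (weight_pos s 0).le).trans (hx 0)
  have hb : 0 ≤ b := (mul_nonneg (abs_nonneg _) (weight_pos s 0).le).trans (hy 0)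
  have hxp : |x p| ≤ a / weight s p := by rw [le_div_iff₀ hp]; exact hx p
  have hyq : |y q| ≤ b / weight s q := by rw [le_div_iff₀ hq]; exact hy q
  rw [abs_mul, abs_mul, abs_of_pos (weight_pos s k)]
  calc |x p| * |y q| * weight s k
      ≤ (a / weight s p) * (b / weight s q) * (2 ^ s * (weight s p + weight s q)) :=
        mul_le_mul (mul_le_mul hxp hyq (abs_nonneg _) (by positivity)) (weight_le_add hs h)
          (weight_pos s k).le (by positivity)
    _ = a * b * (2 ^ s * ((weight s p)⁻¹ + (weight s q)⁻¹)) := by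
        generalize (2 : ℝ) ^ s = c
        generalize weight s p = P at *
        generalize weight s q = Q at *
        field_simp
        ring

theorem conv_mem {s : ℝ} (hs : 1 < s) {x y : ℕ → ℝ} (hx : x ∈ OmegaSub s) (hy : y ∈ OmegaSub s) :
    conv x y ∈ OmegaSub s := by
  obtain ⟨a, ha⟩ := hx
  obtain ⟨b, hb⟩ := hy
  have hsum := summable_inv_weight hs
  refine ⟨a * b * (2 ^ s * ((∑' j : ℤ, (weight s j.natAbs)⁻¹) +
    ∑' j : ℤ, (weight s j.natAbs)⁻¹)), ?_⟩
  rintro _ ⟨k, rfl⟩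
  have hshift := (Equiv.subLeft (k : ℤ)).hasSum_iff.2 hsum.hasSum
  have hG := ((hsum.hasSum.add hshift).mul_left (2 ^ s)).mul_left (a * b)
  have hle := tsum_of_norm_bounded hG (f := fun j : ℤ =>
    x j.natAbs * y ((k : ℤ) - j).natAbs * weight s k) fun j =>
      conv_term_le (by linarith) (fun k => ha ⟨k, rfl⟩) (fun k => hb ⟨k, rfl⟩) (by omega)
  rw [tsum_mul_right, norm_mul, Real.norm_eq_abs, Real.norm_eq_abs,
    abs_of_pos (weight_pos s k)] at hle
  exact hle

/-- The map `f = 𝓛 + N : Ω^s → Ω^{s - s_L}` with the quadratic nonlinearity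
`N(x) = σ (x ∗ x) + g`. -/
def fMap {lam mu bet : ℕ → ℝ} {sL C₁ C₂ δ : ℝ} {k₀ : ℕ}
    (hT : TridiagAssumptions lam mu bet sL C₁ C₂ δ k₀) {s : ℝ} (hs : 1 < s) (σ : ℝ) (g : Omega s)
    (x : Omega s) : Omega (s - sL) :=
  Omega.mk (tridiag lam mu bet x + (σ • conv x x + g))
    ((OmegaSub (s - sL)).add_mem (tridiag_mem hT (by linarith) x.seq_mem)
      (OmegaSub_anti (by linarith [hT.sL_pos])
        ((OmegaSub s).add_mem ((OmegaSub s).smul_mem σ (conv_mem hs x.seq_mem x.seq_mem)) g.seq_mem)))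

/-- The first `m` entries `x_F` of a sequence. -/
def headPart (m : ℕ) (x : ℕ → ℝ) : Fin m → ℝ := fun i => x i

/-- The remaining entries `x_I = (x_m, x_{m+1}, …)` of a sequence. -/
def tailPart (m : ℕ) (x : ℕ → ℝ) : ℕ → ℝ := fun n => x (m + n)

/-- The Galerkin projection `F^{(m)} : ℝ^m → ℝ^m` of a map `F` between the sequence spaces. -/
def galerkin {s t : ℝ} (F : Omega s → Omega t) (m : ℕ) (v : Fin m → ℝ) : Fin m → ℝ :=
  headPart m (F (embed s v))

/-- The Jacobian matrix of `F^{(m)}` at `v`. -/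
def galerkinJacobian {s t : ℝ} (F : Omega s → Omega t) (m : ℕ) (v : Fin m → ℝ) :
    Matrix (Fin m) (Fin m) ℝ :=
  LinearMap.toMatrix' (fderiv ℝ (galerkin F m) v : (Fin m → ℝ) →ₗ[ℝ] (Fin m → ℝ))

/-- The operator `A†`: finite block `D`, one further entry `β_{m-1}` in row `m - 1` and
column `m`, and the rows `m, m+1, …` of the tridiagonal operator. -/
def Adagger (lam mu bet : ℕ → ℝ) (m : ℕ) (D : Matrix (Fin m) (Fin m) ℝ) (z : ℕ → ℝ) (k : ℕ) : ℝ :=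
  if h : k < m then
    D.mulVec (headPart m z) ⟨k, h⟩ + (if k = m - 1 then bet (m - 1) * z m else 0)
  else tridiag lam mu bet z k

/-- The sequence `δ_n` of the `LU` decomposition: `δ_0 = 1`, `δ_1 = b_1`,
`δ_n = b_n δ_{n-1} - a_n c_{n-1} δ_{n-2}`, with `a_n = λ_{m+n-1}`, `b_n = μ_{m+n-1}`,
`c_n = β_{m+n-1}`. -/
def del (lam mu bet : ℕ → ℝ) (m : ℕ) : ℕ → ℝ
  | 0 => 1
  | 1 => mu m
  | n + 2 => mu (m + (n + 1)) * del lam mu bet m (n + 1) -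
      lam (m + (n + 1)) * bet (m + n) * del lam mu bet m n

/-- `L_I⁻¹`. The product is `a_{k-l+2} ⋯ a_{k+1}`. -/
def Linv (lam mu bet : ℕ → ℝ) (m : ℕ) (y : ℕ → ℝ) (k : ℕ) : ℝ :=
  y k + ∑ l ∈ Finset.Icc 1 k, (-1) ^ l * (∏ i ∈ Finset.Icc (k - l + 2) (k + 1), lam (m + (i - 1))) *
    (del lam mu bet m (k - l) / del lam mu bet m k) * y (k - l)

/-- The `l`-th term of the series for entry `k` of `U_I⁻¹ z`. The product is
`c_{k+1} ⋯ c_{k+l}`. -/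
def UinvTerm (lam mu bet : ℕ → ℝ) (m : ℕ) (z : ℕ → ℝ) (k l : ℕ) : ℝ :=
  (-1) ^ l * (del lam mu bet m k / del lam mu bet m (k + l + 1)) *
    (∏ i ∈ Finset.Icc (k + 1) (k + l), bet (m + (i - 1))) * z (k + l)

/-- `U_I⁻¹`. -/
def Uinv (lam mu bet : ℕ → ℝ) (m : ℕ) (z : ℕ → ℝ) (k : ℕ) : ℝ :=
  ∑' l : ℕ, UinvTerm lam mu bet m z k l

/-- `U_I⁻¹ L_I⁻¹`. -/
def ULinv (lam mu bet : ℕ → ℝ) (m : ℕ) (y : ℕ → ℝ) : ℕ → ℝ :=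
  Uinv lam mu bet m (Linv lam mu bet m y)

/-- All the series that define `U_I⁻¹ L_I⁻¹ y` converge. -/
def ULinvConverges (lam mu bet : ℕ → ℝ) (m : ℕ) (y : ℕ → ℝ) : Prop :=
  ∀ k, Summable (UinvTerm lam mu bet m (Linv lam mu bet m y) k)

/-- `e₁ = (1, 0, 0, …)`. -/
def e₁ : ℕ → ℝ := Pi.single 0 1

/-- `w_I = U_I⁻¹ L_I⁻¹ e₁`. -/
def wI (lam mu bet : ℕ → ℝ) (m : ℕ) : ℕ → ℝ := ULinv lam mu bet m e₁

/-- The index `m - 1` of the last row and column. -/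
def lastIdx {m : ℕ} (hm : 0 < m) : Fin m := ⟨m - 1, Nat.sub_lt hm one_pos⟩

/-- The approximate inverse `A` of `A†` built from the matrix `Am`. -/
def Aop (lam mu bet : ℕ → ℝ) {m : ℕ} (hm : 0 < m) (Am : Matrix (Fin m) (Fin m) ℝ)
    (v : ℕ → ℝ) (k : ℕ) : ℝ :=
  if h : k < m then
    Am.mulVec (headPart m v) ⟨k, h⟩ -
      bet (m - 1) * ULinv lam mu bet m (tailPart m v) 0 * Am ⟨k, h⟩ (lastIdx hm)
  else
    -lam m * Am.mulVec (headPart m v) (lastIdx hm) * wI lam mu bet m (k - m) +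
      (ULinv lam mu bet m (tailPart m v) (k - m) +
        bet (m - 1) * lam m * Am (lastIdx hm) (lastIdx hm) *
          ULinv lam mu bet m (tailPart m v) 0 * wI lam mu bet m (k - m))

/-- `γ = 1/2 + √(1/4 - δ²)`. -/
def gam (δ : ℝ) : ℝ := 1 / 2 + Real.sqrt (1 / 4 - δ ^ 2)

/-- `θ = δ / γ`. -/
def theta (δ : ℝ) : ℝ := δ / gam δ

/-- `η = 1 / (γ (1 - θ²))`. -/
def eta (δ : ℝ) : ℝ := 1 / (gam δ * (1 - theta δ ^ 2))

/-- The constants `χ(θ, m, M, s, s_L)`. -/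
def chi (θ : ℝ) (m M : ℕ) (s sL : ℝ) : ℝ :=
  θ ^ ((M : ℝ) / 2) * ((M : ℝ) / 2) * (((m : ℝ) + M) / m) ^ (s + sL) +
    θ ^ Real.sqrt M * ((M : ℝ) / 2) * 2 ^ (s + sL) +
    1 / (1 - θ) * (((m : ℝ) + M) / ((m : ℝ) + M - Real.sqrt M - 1)) ^ (s + sL)

/-- The first lower bound on `M`. -/
def CondMA (θ : ℝ) (m M : ℕ) (s sL : ℝ) : Prop :=
  max (max ((-(m : ℝ) * Real.log (Real.sqrt θ) - s - sL - 1 -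
        Real.sqrt (((m : ℝ) * Real.log (Real.sqrt θ) + s + sL + 1) ^ 2 -
          4 * m * Real.log (Real.sqrt θ))) / (2 * Real.log (Real.sqrt θ)))
      (4 / Real.log θ ^ 2)) (m : ℝ) ≤ (M : ℝ)

/-- The second lower bound on `M`. -/
def CondMY (θ : ℝ) (m M : ℕ) (s : ℝ) : Prop :=
  max (-s / Real.log θ - m) ((m : ℝ) - 2) ≤ (M : ℝ)

/-- The convolution constants `α_k^s(n)`, with computational parameter `L`. -/
def alpha (s : ℝ) (L n k : ℕ) : ℝ :=
  if k = 0 then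
    1 + 2 * ∑ l ∈ Finset.Icc 1 L, 1 / (l : ℝ) ^ s + 2 / ((s - 1) * (L : ℝ) ^ (s - 1))
  else if k < n then
    2 + 2 * ∑ l ∈ Finset.Icc 1 L, 1 / (l : ℝ) ^ s + 2 / ((s - 1) * (L : ℝ) ^ (s - 1)) +
      ∑ l ∈ Finset.Icc 1 (k - 1), (k : ℝ) ^ s / ((l : ℝ) ^ s * ((k : ℝ) - l) ^ s)
  else
    2 + 2 * ∑ l ∈ Finset.Icc 1 L, 1 / (l : ℝ) ^ s + 2 / ((s - 1) * (L : ℝ) ^ (s - 1)) +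
      2 * ((n : ℝ) / ((n : ℝ) - 1)) ^ s +
      (4 * Real.log ((n : ℝ) - 2) / n + (Real.pi ^ 2 - 6) / 3) * (2 / (n : ℝ) + 1 / 2) ^ (s - 2)

/-- The finite part `C¹_F` of the bound for the first order term. -/
def C1head (s σ : ℝ) {m : ℕ} (xbar : Fin m → ℝ) : Fin m → ℝ := fun k =>
  if (k : ℕ) = 0 then 0
  else 2 * |σ| * ∑ l ∈ Finset.Icc (m - k) (m - 1), |extendZero xbar l| / weight s (k + l)

/-- The finite part `C²_F` of the bound for the second order term. -/
def C2head (s σ : ℝ) (L m : ℕ) : Fin m → ℝ := fun k =>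
  2 * |σ| * alpha s L m k / weight s k

/-- The common shape of the vectors `D¹` and `D²`: a componentwise bound for `|A| C`, where `C`
has finite part `CF` and tail `C_{m+k} = κ / ω_{m+k}^s`. -/
def Dvec (lam mu bet : ℕ → ℝ) (s sL C₁ δ : ℝ) {m : ℕ} (hm : 0 < m)
    (Am : Matrix (Fin m) (Fin m) ℝ) (M : ℕ) (CF : Fin m → ℝ) (κ : ℝ) (k : ℕ) : ℝ :=
  let θ := theta δ
  let η := eta δ
  let absAm : Matrix (Fin m) (Fin m) ℝ := fun i j => |Am i j|
  -- the coefficient of `θ^n` in the components of index `m + n`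
  let front : ℝ := (absAm.mulVec CF (lastIdx hm) +
    |bet (m - 1)| * absAm (lastIdx hm) (lastIdx hm) * η * κ /
      (C₁ * (1 - θ) * weight (s + sL) m)) * η * (|lam m| / |mu m|)
  -- the component of index `m + M`
  let atM : ℝ := front * θ ^ M + η * κ / (C₁ * weight (s + sL) (m + M)) * (chi θ m M s sL + θ / (1 - θ))
  if h : k < m then
    absAm.mulVec CF ⟨k, h⟩ +
      |bet (m - 1)| * η * κ / (C₁ * (1 - θ) * weight (s + sL) m) * absAm ⟨k, h⟩ (lastIdx hm)
  else if k < m + M then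
    front * θ ^ (k - m) + η * κ / (C₁ * weight (s + sL) k) *
      (∑ l ∈ Finset.range (k - m + 1), θ ^ (k - m - l) * ((k : ℝ) / ((m : ℝ) + l)) ^ (s + sL) +
        θ / (1 - θ))
  else atM * (weight s (m + M) / weight s k)

/-- The vector `D¹(x̄)`. -/
def D1 (lam mu bet : ℕ → ℝ) (s sL C₁ δ σ : ℝ) (L : ℕ) {m : ℕ} (hm : 0 < m)
    (Am : Matrix (Fin m) (Fin m) ℝ) (M : ℕ) (xbar : Fin m → ℝ) : ℕ → ℝ :=
  Dvec lam mu bet s sL C₁ δ hm Am M (C1head s σ xbar) (2 * |σ| * alpha s L m m * ‖embed s xbar‖)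

/-- The vector `D²`. -/
def D2 (lam mu bet : ℕ → ℝ) (s sL C₁ δ σ : ℝ) (L : ℕ) {m : ℕ} (hm : 0 < m)
    (Am : Matrix (Fin m) (Fin m) ℝ) (M : ℕ) : ℕ → ℝ :=
  Dvec lam mu bet s sL C₁ δ hm Am M (C2head s σ L m) (2 * |σ| * alpha s L m m)

/-- `Z²(r) = D¹(x̄) r + D² r²`. -/
def Z2 (lam mu bet : ℕ → ℝ) (s sL C₁ δ σ : ℝ) (L : ℕ) {m : ℕ} (hm : 0 < m)
    (Am : Matrix (Fin m) (Fin m) ℝ) (M : ℕ) (xbar : Fin m → ℝ) (r : ℝ) : ℕ → ℝ := fun k =>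
  D1 lam mu bet s sL C₁ δ σ L hm Am M xbar k * r + D2 lam mu bet s sL C₁ δ σ L hm Am M k * r ^ 2

end TridiagNewton

end

open TridiagNewton

noncomputable section
namespace TridiagNewton

/-! Since `f` is a continuous linear map plus a bounded quadratic form plus a constant, its
derivative at `x` sends `z` to `𝓛 z + 2σ (x ∗ z)`. The operator `A†` contains all of `𝓛`, and also
the convolution of `x̄` with the head of `z` in the head rows. What remains is purely a convolution:
`2σ x̄ ∗ z_I + 2σ y ∗ z` in the head (`residual_head`) and `2σ x̄ ∗ z + 2σ y ∗ z` in the tail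
(`residual_tail`). The estimates `abs_conv_dropHead_le`, `abs_conv_le_head` and `abs_conv_le_tail`
bound the head by a vector `CF` and the tail by `κ / ω_k^s`.

To push such a bound through `A`, the tail inverse `U_I⁻¹ L_I⁻¹` must be controlled. The number `γ`
is the larger root of `γ² - γ + δ² = 0`, that is `γ = 1 - δθ`. This is what lets the recurrence for
`δ_n` propagate `|δ_{n+1}| ≥ γ |μ_{m+n}| |δ_n|` (`TailDominant.del_aux`). Each off-diagonal factor
then costs at most `θ`, so both inverses have geometrically decaying entries. Summing the double
geometric series gives the factor `η` and the term `θ / (1 - θ)` (`TailDominant.abs_ULinv_le`).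

Up to index `m + M` the resulting sums stay explicit. Beyond it they satisfy a one-step recurrence
for which `χ` is an upper barrier (`geomSum_le_chi`), and `θ^n` decays faster than the weight grows
(`pow_mul_weight_le`). Hence the closed tail of `Dvec` is valid (`abs_Aop_le_Dvec`). Finally `Dvec`
is linear in `(CF, κ)`, so the parts of first and second order in `r` separate into `D1` and `D2`.
-/

/-! ### Convolution and the tridiagonal operator as bounded maps; derivatives of `f` and its
projection. -/

theorem Omega.abs_le (s : ℝ) (x : Omega s) (k : ℕ) : |x k| ≤ ‖x‖ / weight s k := by
  rw [le_div_iff₀ (weight_pos s k)]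
  exact x.le_norm k

theorem Omega.norm_le {s C : ℝ} {x : Omega s} (h : ∀ k, |x k| * weight s k ≤ C) : ‖x‖ ≤ C :=
  ciSup_le h

theorem summable_conv {s : ℝ} (hs : 1 < s) {x y : ℕ → ℝ} (hx : x ∈ OmegaSub s)
    (hy : y ∈ OmegaSub s) (k : ℕ) :
    Summable fun j : ℤ => x j.natAbs * y ((k : ℤ) - j).natAbs := by
  obtain ⟨a, ha⟩ := hx
  obtain ⟨b, hb⟩ := hy
  have hsum := summable_inv_weight hs
  have hshift := (Equiv.subLeft (k : ℤ)).hasSum_iff.2 hsum.hasSum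
  have hG := ((hsum.hasSum.add hshift).mul_left (2 ^ s)).mul_left (a * b)
  have h : Summable fun j : ℤ => x j.natAbs * y ((k : ℤ) - j).natAbs * weight s k :=
    Summable.of_norm_bounded hG.summable fun j =>
      conv_term_le (by linarith) (fun k => ha ⟨k, rfl⟩) (fun k => hb ⟨k, rfl⟩) (by omega)
  exact (summable_mul_right_iff (weight_pos s k).ne').1 h

theorem conv_comm (x y : ℕ → ℝ) (k : ℕ) : conv x y k = conv y x k := by
  unfold conv
  rw [← (Equiv.subLeft (k : ℤ)).tsum_eq]
  refine tsum_congr fun j => ?_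
  simp [mul_comm]

theorem conv_add_right {s : ℝ} (hs : 1 < s) {x y z : ℕ → ℝ} (hx : x ∈ OmegaSub s)
    (hy : y ∈ OmegaSub s) (hz : z ∈ OmegaSub s) (k : ℕ) :
    conv x (y + z) k = conv x y k + conv x z k := by
  unfold conv
  rw [← (summable_conv hs hx hy k).tsum_add (summable_conv hs hx hz k)]
  exact tsum_congr fun j => by simp [mul_add]

theorem conv_smul_right (c : ℝ) (x y : ℕ → ℝ) (k : ℕ) :
    conv x (c • y) k = c * conv x y k := by
  unfold conv
  rw [← tsum_mul_left]
  exact tsum_congr fun j => by simp only [Pi.smul_apply, smul_eq_mul]; ring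

theorem conv_add_left {s : ℝ} (hs : 1 < s) {x y z : ℕ → ℝ} (hx : x ∈ OmegaSub s)
    (hy : y ∈ OmegaSub s) (hz : z ∈ OmegaSub s) (k : ℕ) :
    conv (x + y) z k = conv x z k + conv y z k := by
  rw [conv_comm, conv_add_right hs hz hx hy, conv_comm z, conv_comm z]

theorem conv_smul_left (c : ℝ) (x y : ℕ → ℝ) (k : ℕ) :
    conv (c • x) y k = c * conv x y k := by
  rw [conv_comm, conv_smul_right, conv_comm]

/-- A constant for which `‖x ∗ y‖_s ≤ C ‖x‖_s ‖y‖_s`. -/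
def convConst (s : ℝ) : ℝ :=
  2 ^ s * ((∑' j : ℤ, (weight s j.natAbs)⁻¹) + ∑' j : ℤ, (weight s j.natAbs)⁻¹)

theorem abs_conv_mul_weight_le {s : ℝ} (hs : 1 < s) (x y : Omega s) (k : ℕ) :
    |conv x y k| * weight s k ≤ convConst s * ‖x‖ * ‖y‖ := by
  have hsum := summable_inv_weight hs
  have hshift := (Equiv.subLeft (k : ℤ)).hasSum_iff.2 hsum.hasSum
  have hG := ((hsum.hasSum.add hshift).mul_left (2 ^ s)).mul_left (‖x‖ * ‖y‖)
  have hle := tsum_of_norm_bounded hG (f := fun j : ℤ =>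
    x j.natAbs * y ((k : ℤ) - j).natAbs * weight s k) fun j =>
      conv_term_le (by linarith) x.le_norm y.le_norm (by omega)
  rw [tsum_mul_right, norm_mul, Real.norm_eq_abs, Real.norm_eq_abs,
    abs_of_pos (weight_pos s k)] at hle
  refine hle.trans (le_of_eq ?_)
  unfold convConst
  ring

/-- The convolution as a continuous bilinear map. -/
def convCLM {s t : ℝ} (hs : 1 < s) (hts : t ≤ s) : Omega s →L[ℝ] Omega s →L[ℝ] Omega t :=
  LinearMap.mkContinuous₂
    (LinearMap.mk₂ ℝ
      (fun x y => Omega.mk (conv x y) (OmegaSub_anti hts (conv_mem hs x.seq_mem y.seq_mem)))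
      (fun x y z => Omega.ext_seq fun k => conv_add_left hs x.seq_mem y.seq_mem z.seq_mem k)
      (fun c x y => Omega.ext_seq fun k => conv_smul_left c x y k)
      (fun x y z => Omega.ext_seq fun k => conv_add_right hs x.seq_mem y.seq_mem z.seq_mem k)
      (fun c x y => Omega.ext_seq fun k => conv_smul_right c x y k))
    (convConst s) (fun x y => Omega.norm_le fun k =>
      (mul_le_mul_of_nonneg_left (weight_mono hts k) (abs_nonneg _)).trans
        (abs_conv_mul_weight_le hs x y k))

theorem tridiag_add (lam mu bet x y : ℕ → ℝ) (k : ℕ) :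
    tridiag lam mu bet (x + y) k = tridiag lam mu bet x k + tridiag lam mu bet y k := by
  rcases k with _ | k <;> simp only [tridiag, Pi.add_apply] <;> ring

theorem tridiag_smul (lam mu bet x : ℕ → ℝ) (c : ℝ) (k : ℕ) :
    tridiag lam mu bet (c • x) k = c * tridiag lam mu bet x k := by
  rcases k with _ | k <;> simp only [tridiag, Pi.smul_apply, smul_eq_mul] <;> ring

theorem abs_tridiag_mul_weight_le {lam mu bet : ℕ → ℝ} {sL C₁ C₂ δ : ℝ} {k₀ : ℕ}
    (hT : TridiagAssumptions lam mu bet sL C₁ C₂ δ k₀) {s : ℝ} (hs : 0 ≤ s) (x : Omega s) (k : ℕ) :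
    |tridiag lam mu bet x k| * weight (s - sL) k ≤ 3 * (C₂ * 2 ^ s) * ‖x‖ := by
  have hC : 0 ≤ C₂ := hT.C₁_pos.le.trans hT.C₁_le_C₂
  have h2 : (1 : ℝ) ≤ 2 ^ s := Real.one_le_rpow (by norm_num) hs
  have key : ∀ (c : ℝ) (j k : ℕ), |c / weight sL k| ≤ C₂ → weight s k ≤ 2 ^ s * weight s j →
      |c * x j| * weight (s - sL) k ≤ C₂ * (2 ^ s * ‖x‖) := by
    intro c j k hc hjk
    have hw := weight_pos sL k
    rw [abs_div, abs_of_pos hw, div_le_iff₀ hw] at hc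
    have e : weight sL k * weight (s - sL) k = weight s k := by rw [weight_mul]; congr 1; ring
    calc |c * x j| * weight (s - sL) k = |c| * (|x j| * weight (s - sL) k) := by
          rw [abs_mul]; ring
      _ ≤ (C₂ * weight sL k) * (|x j| * weight (s - sL) k) :=
          mul_le_mul_of_nonneg_right hc (mul_nonneg (abs_nonneg _) (weight_pos _ _).le)
      _ = C₂ * (|x j| * weight s k) := by rw [← e]; ring
      _ ≤ C₂ * (|x j| * (2 ^ s * weight s j)) := by gcongr
      _ = C₂ * (2 ^ s * (|x j| * weight s j)) := by ring
      _ ≤ C₂ * (2 ^ s * ‖x‖) := by gcongr; exact x.le_norm j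
  have self : ∀ k, weight s k ≤ 2 ^ s * weight s k := fun k =>
    le_mul_of_one_le_left (weight_pos s k).le h2
  have up : ∀ k, weight s k ≤ 2 ^ s * weight s (k + 1) := fun k =>
    (weight_le_succ hs k).trans (self (k + 1))
  have hpos : 0 ≤ C₂ * (2 ^ s * ‖x‖) := by positivity
  rcases k with _ | k
  · have i1 := key (mu 0) 0 0 (hT.mu_le 0) (self 0)
    have i2 := key (bet 0) 1 0 (hT.bet_le 0) (up 0)
    have i3 := mul_le_mul_of_nonneg_right (abs_add_le (mu 0 * x 0) (bet 0 * x 1))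
      (weight_pos (s - sL) 0).le
    change |mu 0 * x 0 + bet 0 * x 1| * weight (s - sL) 0 ≤ _
    linarith
  · have i1 := key (mu (k + 1)) (k + 1) (k + 1) (hT.mu_le _) (self _)
    have i2 := key (bet (k + 1)) (k + 2) (k + 1) (hT.bet_le _) (up _)
    have i0 := key (lam (k + 1)) k (k + 1) (hT.lam_le _) (weight_succ_le hs k)
    have i3 := mul_le_mul_of_nonneg_right
      (abs_add_three (lam (k + 1) * x k) (mu (k + 1) * x (k + 1)) (bet (k + 1) * x (k + 2)))
      (weight_pos (s - sL) (k + 1)).le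
    change |lam (k + 1) * x k + mu (k + 1) * x (k + 1) + bet (k + 1) * x (k + 2)| *
      weight (s - sL) (k + 1) ≤ _
    linarith

/-- The tridiagonal operator as a continuous linear map. -/
def tridiagCLM {lam mu bet : ℕ → ℝ} {sL C₁ C₂ δ : ℝ} {k₀ : ℕ}
    (hT : TridiagAssumptions lam mu bet sL C₁ C₂ δ k₀) {s : ℝ} (hs : 0 ≤ s) :
    Omega s →L[ℝ] Omega (s - sL) :=
  LinearMap.mkContinuous
    { toFun := fun x => Omega.mk (tridiag lam mu bet x) (tridiag_mem hT hs x.seq_mem)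
      map_add' := fun x y => Omega.ext_seq fun k => tridiag_add lam mu bet x y k
      map_smul' := fun c x => Omega.ext_seq fun k => tridiag_smul lam mu bet x c k }
    (3 * (C₂ * 2 ^ s)) (fun x => Omega.norm_le fun k => abs_tridiag_mul_weight_le hT hs x k)

section Derivative

variable {lam mu bet : ℕ → ℝ} {sL C₁ C₂ δ : ℝ} {k₀ : ℕ}
  (hT : TridiagAssumptions lam mu bet sL C₁ C₂ δ k₀) {s : ℝ} (hs : 1 < s) (σ : ℝ) (g : Omega s)

theorem hasFDerivAt_fMap (x : Omega s) :
    HasFDerivAt (fMap hT hs σ g)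
      (tridiagCLM hT (by linarith) +
        σ • (convCLM hs (by linarith [hT.sL_pos]) x +
          (convCLM hs (by linarith [hT.sL_pos])).flip x)) x := by
  have hts : s - sL ≤ s := by linarith [hT.sL_pos]
  -- Linear part, diagonal of a bilinear map, constant: each summand then has a standard derivative.
  -- The two slots of the bilinear map coincide only after `conv_comm`, so they are kept apart here.
  have e : fMap hT hs σ g = fun x => tridiagCLM hT (by linarith) x +
      (σ • convCLM hs hts x x + Omega.mk g (OmegaSub_anti hts g.seq_mem)) := by
    funext x
    exact Omega.ext_seq fun k => rfl
  rw [e]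
  refine (tridiagCLM hT (by linarith)).hasFDerivAt.add (HasFDerivAt.add_const _ ?_)
  have h := (convCLM hs hts).hasFDerivAt_of_bilinear (hasFDerivAt_id x) (hasFDerivAt_id x)
  have h' := h.const_smul σ
  refine h'.congr_fderiv ?_
  ext z
  simp [ContinuousLinearMap.precompR, ContinuousLinearMap.precompL]

theorem fderiv_fMap_apply (x z : Omega s) (k : ℕ) :
    (fderiv ℝ (fMap hT hs σ g) x z) k = tridiag lam mu bet z k + 2 * σ * conv x z k := by
  rw [(hasFDerivAt_fMap hT hs σ g x).fderiv]
  have : tridiag lam mu bet z k + σ * (conv x z k + conv z x k) =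
      tridiag lam mu bet z k + 2 * σ * conv x z k := by
    rw [conv_comm z x]; ring
  exact this

/-- `ℝ^m → Ω^s` as a continuous linear map. -/
def embedCLM (s : ℝ) (m : ℕ) : (Fin m → ℝ) →L[ℝ] Omega s :=
  LinearMap.toContinuousLinearMap
    { toFun := fun v => embed s v
      map_add' := fun v w => Omega.ext_seq fun k => by
        change extendZero (v + w) k = extendZero v k + extendZero w k
        unfold extendZero
        split_ifs <;> simp
      map_smul' := fun c v => Omega.ext_seq fun k => by
        change extendZero (c • v) k = c * extendZero v k
        unfold extendZero
        split_ifs <;> simp }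

/-- The projection `Ω^s → ℝ^m` as a continuous linear map. -/
def headCLM (s : ℝ) (m : ℕ) : Omega s →L[ℝ] (Fin m → ℝ) :=
  ContinuousLinearMap.pi fun i : Fin m => LinearMap.mkContinuous
    { toFun := fun x : Omega s => x (i : ℕ)
      map_add' := fun x y => rfl
      map_smul' := fun c x => rfl }
    (weight s i)⁻¹ (fun x => by
      have := Omega.abs_le s x i
      rw [div_eq_inv_mul] at this
      exact this)

theorem hasFDerivAt_galerkin (m : ℕ) (v : Fin m → ℝ) :
    HasFDerivAt (galerkin (fMap hT hs σ g) m)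
      ((headCLM (s - sL) m).comp
        ((fderiv ℝ (fMap hT hs σ g) (embed s v)).comp (embedCLM s m))) v := by
  have h1 : HasFDerivAt (fMap hT hs σ g) (fderiv ℝ (fMap hT hs σ g) (embed s v))
      (embedCLM s m v) := (hasFDerivAt_fMap hT hs σ g _).differentiableAt.hasFDerivAt
  exact (headCLM (s - sL) m).hasFDerivAt.comp v (h1.comp v (embedCLM s m).hasFDerivAt)

theorem galerkinJacobian_mulVec (m : ℕ) (v w : Fin m → ℝ) (i : Fin m) :
    (galerkinJacobian (fMap hT hs σ g) m v).mulVec w i =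
      tridiag lam mu bet (extendZero w) i + 2 * σ * conv (extendZero v) (extendZero w) i := by
  unfold galerkinJacobian
  rw [LinearMap.toMatrix'_mulVec, (hasFDerivAt_galerkin hT hs σ g m v).fderiv]
  exact fderiv_fMap_apply hT hs σ g (embed s v) (embed s w) i

end Derivative

/-! ### The residual `(Df(x̄ + y) - A†) z`. -/

theorem extendZero_headPart (m : ℕ) (z : ℕ → ℝ) (k : ℕ) :
    extendZero (headPart m z) k = if k < m then z k else 0 := by
  unfold extendZero headPart
  split_ifs <;> rfl

/-- The sequence `z` with its first `m` entries replaced by zero. -/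
def dropHead (m : ℕ) (z : ℕ → ℝ) (k : ℕ) : ℝ := if k < m then 0 else z k

theorem head_add_dropHead (m : ℕ) (z : ℕ → ℝ) : extendZero (headPart m z) + dropHead m z = z := by
  funext k
  rw [Pi.add_apply, extendZero_headPart]
  unfold dropHead
  split_ifs <;> simp

theorem dropHead_mem {s : ℝ} {z : ℕ → ℝ} (hz : z ∈ OmegaSub s) (m : ℕ) :
    dropHead m z ∈ OmegaSub s := by
  have h := (OmegaSub s).sub_mem hz (extendZero_mem s (headPart m z))
  rwa [← eq_sub_of_add_eq' (head_add_dropHead m z)] at h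

/-- A row of index below `m` reaches at most one step to the right, so only row `m - 1` meets a
nonzero entry. This is exactly the extra entry of `A†`, and the reason why no linear term survives
in the residual. -/
theorem tridiag_dropHead (lam mu bet z : ℕ → ℝ) {m k : ℕ} (h : k < m) :
    tridiag lam mu bet (dropHead m z) k = if k = m - 1 then bet (m - 1) * z m else 0 := by
  rcases k with _ | k
  · simp only [tridiag, dropHead]
    by_cases h1 : m = 1
    · subst h1; simp
    · rw [if_neg (by omega : ¬ 0 = m - 1), if_pos h, if_pos (by omega)]; ring
  · simp only [tridiag, dropHead]
    by_cases h1 : k + 2 = m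
    · subst h1; simp
    · rw [if_neg (by omega : ¬ k + 1 = m - 1), if_pos h, if_pos (by omega : k < m),
        if_pos (by omega : k + 2 < m)]
      ring

section Residual

variable {lam mu bet : ℕ → ℝ} {sL C₁ C₂ δ : ℝ} {k₀ : ℕ}
  (hT : TridiagAssumptions lam mu bet sL C₁ C₂ δ k₀) {s : ℝ} (hs : 1 < s) (σ : ℝ) (g : Omega s)

/-- Splitting `z` into head and tail, the Jacobian block accounts for the head and the extra entry
of `A†` for the linear action on the tail. Of the convolution with `x̄` only the tail of `z` is
left. -/
theorem residual_head {m : ℕ} (xbar : Fin m → ℝ) (y z : Omega s) {k : ℕ} (h : k < m) :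
    (fderiv ℝ (fMap hT hs σ g) (embed s xbar + y) z) k -
      Adagger lam mu bet m (galerkinJacobian (fMap hT hs σ g) m xbar) z k =
    2 * σ * conv (extendZero xbar) (dropHead m z) k + 2 * σ * conv y z k := by
  rw [fderiv_fMap_apply, Adagger, dif_pos h, galerkinJacobian_mulVec,
    ← tridiag_dropHead lam mu bet z h]
  have e : conv (embed s xbar + y : Omega s) z k = conv (extendZero xbar) z k + conv y z k :=
    conv_add_left hs (extendZero_mem s xbar) y.seq_mem z.seq_mem k
  have e1 := tridiag_add lam mu bet (extendZero (headPart m z)) (dropHead m z) k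
  have e2 := conv_add_right hs (extendZero_mem s xbar) (extendZero_mem s (headPart m z))
    (dropHead_mem z.seq_mem m) k
  rw [head_add_dropHead] at e1 e2
  rw [e, e1, e2]
  ring

theorem residual_tail {m : ℕ} (xbar : Fin m → ℝ) (y z : Omega s) {k : ℕ} (h : m ≤ k) :
    (fderiv ℝ (fMap hT hs σ g) (embed s xbar + y) z) k -
      Adagger lam mu bet m (galerkinJacobian (fMap hT hs σ g) m xbar) z k =
    2 * σ * conv (embed s xbar) z k + 2 * σ * conv y z k := by
  rw [fderiv_fMap_apply, Adagger, dif_neg (by omega)]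
  have e : conv (embed s xbar + y : Omega s) z k = conv (embed s xbar) z k + conv y z k :=
    conv_add_left hs (extendZero_mem s xbar) y.seq_mem z.seq_mem k
  rw [e]
  ring

end Residual

/-! ### Convolution estimates and the constants `α_k`. -/

/-- The integral comparison for `x^{-s}` on `[n, n + 1]` in telescoping form. It reduces to
`((n+1)/n)^{s-1} ≥ 1 + (s-1)/(n+1)`, which follows from `log ((n+1)/n) ≥ 1/(n+1)` and `exp u ≥ 1 +
u`. -/
theorem inv_succ_rpow_le {s : ℝ} (hs : 1 < s) {n : ℕ} (hn : 1 ≤ n) :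
    1 / ((n + 1 : ℕ) : ℝ) ^ s ≤
      1 / ((s - 1) * (n : ℝ) ^ (s - 1)) - 1 / ((s - 1) * ((n + 1 : ℕ) : ℝ) ^ (s - 1)) := by
  have hn0 : (0 : ℝ) < n := by exact_mod_cast hn
  push_cast
  set a : ℝ := (n : ℝ)
  have hs1 : 0 < s - 1 := by linarith
  have hb0 : 0 < a + 1 := by linarith
  have hA : 0 < a ^ (s - 1) := Real.rpow_pos_of_pos hn0 _
  have hB : 0 < (a + 1) ^ (s - 1) := Real.rpow_pos_of_pos hb0 _
  have e1 : (a + 1) ^ s = (a + 1) ^ (s - 1) * (a + 1) := by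
    conv_rhs => rw [← Real.rpow_add_one hb0.ne']
    congr 1; ring
  have hlog : 1 / (a + 1) ≤ Real.log ((a + 1) / a) := by
    have h1 := Real.log_le_sub_one_of_pos (div_pos hn0 hb0)
    rw [← inv_div (a + 1) a, Real.log_inv] at h1
    have h2 : ((a + 1) / a)⁻¹ - 1 = -(1 / (a + 1)) := by field_simp; ring
    linarith
  have hR : 1 + (s - 1) / (a + 1) ≤ (a + 1) ^ (s - 1) / a ^ (s - 1) := by
    rw [← Real.div_rpow hb0.le hn0.le, Real.rpow_def_of_pos (div_pos hb0 hn0)]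
    have h1 := Real.add_one_le_exp (Real.log ((a + 1) / a) * (s - 1))
    have h2 := mul_le_mul_of_nonneg_right hlog hs1.le
    have h3 : (s - 1) / (a + 1) = 1 / (a + 1) * (s - 1) := by ring
    linarith
  rw [e1]
  set A := a ^ (s - 1)
  set B := (a + 1) ^ (s - 1)
  have : 1 / ((s - 1) * A) - 1 / ((s - 1) * B) - 1 / (B * (a + 1)) =
      (B / A - (1 + (s - 1) / (a + 1))) / ((s - 1) * B) := by
    field_simp
    ring
  have h4 : 0 ≤ (B / A - (1 + (s - 1) / (a + 1))) / ((s - 1) * B) :=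
    div_nonneg (by linarith) (by positivity)
  linarith

/-- An upper bound for `∑_{n ≥ 1} n^{-s}`. -/
def zetaBound (s : ℝ) (L : ℕ) : ℝ :=
  ∑ l ∈ Finset.Icc 1 L, 1 / (l : ℝ) ^ s + 1 / ((s - 1) * (L : ℝ) ^ (s - 1))

theorem sum_range_inv_rpow_le {s : ℝ} (hs : 1 < s) {L : ℕ} (hL : 1 ≤ L) (N : ℕ) :
    ∑ n ∈ Finset.range N, 1 / ((n + 1 : ℕ) : ℝ) ^ s ≤ zetaBound s L := by
  have hpos : ∀ n : ℕ, 0 ≤ 1 / ((s - 1) * (n : ℝ) ^ (s - 1)) := fun n => by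
    have : 0 < s - 1 := by linarith
    positivity
  -- Partial sum plus integral remainder is nonincreasing in `K` and equals `zetaBound s L` at `K =
  -- L`.
  have key : ∀ K, L ≤ K → ∑ n ∈ Finset.range K, 1 / ((n + 1 : ℕ) : ℝ) ^ s +
      1 / ((s - 1) * (K : ℝ) ^ (s - 1)) ≤ zetaBound s L := by
    intro K hK
    induction K, hK using Nat.le_induction with
    | base =>
      refine le_of_eq ?_
      unfold zetaBound
      congr 1
      rw [← Finset.Ico_add_one_right_eq_Icc, Finset.sum_Ico_eq_sum_range]
      refine Finset.sum_congr (by simp) fun n _ => by rw [add_comm n 1]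
    | succ K hK ih =>
      rw [Finset.sum_range_succ]
      linarith [inv_succ_rpow_le hs (hL.trans hK)]
  refine le_trans ?_ (key (max N L) (le_max_right _ _))
  have h1 : ∑ n ∈ Finset.range N, 1 / ((n + 1 : ℕ) : ℝ) ^ s ≤
      ∑ n ∈ Finset.range (max N L), 1 / ((n + 1 : ℕ) : ℝ) ^ s :=
    Finset.sum_le_sum_of_subset_of_nonneg (Finset.range_mono (le_max_left _ _))
      fun _ _ _ => by positivity
  linarith [hpos (max N L)]

theorem summable_inv_succ_rpow {s : ℝ} (hs : 1 < s) :
    Summable fun n : ℕ => 1 / ((n + 1 : ℕ) : ℝ) ^ s := by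
  have := (summable_nat_add_iff 1).2 (Real.summable_one_div_nat_rpow.2 hs)
  exact this

theorem tsum_inv_succ_rpow_le {s : ℝ} (hs : 1 < s) {L : ℕ} (hL : 1 ≤ L) :
    ∑' n : ℕ, 1 / ((n + 1 : ℕ) : ℝ) ^ s ≤ zetaBound s L :=
  Real.tsum_le_of_sum_range_le (fun _ => by positivity) (sum_range_inv_rpow_le hs hL)

/-- The integers split into `0 ≤ j ≤ k`, `j = k + n + 1` and `j = -(n + 1)`. In the last two ranges
the indices differ by `k`, with the larger one on `x` and on `y` respectively. -/
theorem conv_eq {s : ℝ} (hs : 1 < s) {x y : ℕ → ℝ} (hx : x ∈ OmegaSub s)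
    (hy : y ∈ OmegaSub s) (k : ℕ) :
    conv x y k = ∑ j ∈ Finset.range (k + 1), x j * y (k - j) +
      ∑' n : ℕ, x (k + n + 1) * y (n + 1) + ∑' n : ℕ, x (n + 1) * y (k + n + 1) := by
  have h := summable_conv hs hx hy k
  have h1 : Summable fun n : ℕ => x n * y ((k : ℤ) - n).natAbs := by
    have := h.comp_injective (Nat.cast_injective (R := ℤ))
    simpa [Function.comp_def] using this
  have h2 : Summable fun n : ℕ => x (n + 1) * y (k + n + 1) := by
    have hi : Function.Injective fun n : ℕ => -((n : ℤ) + 1) := fun a b hab => by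
      simp only at hab; omega
    refine (h.comp_injective hi).congr fun n => ?_
    simp only [Function.comp_apply]
    rw [show (-((n : ℤ) + 1)).natAbs = n + 1 by omega,
      show ((k : ℤ) - -((n : ℤ) + 1)).natAbs = k + n + 1 by omega]
  have e2 : ∀ n : ℕ, x (-((n : ℤ) + 1)).natAbs * y ((k : ℤ) - -((n : ℤ) + 1)).natAbs =
      x (n + 1) * y (k + n + 1) := fun n => by
    rw [show (-((n : ℤ) + 1)).natAbs = n + 1 by omega,
      show ((k : ℤ) - -((n : ℤ) + 1)).natAbs = k + n + 1 by omega]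
  unfold conv
  rw [tsum_of_nat_of_neg_add_one (by simpa using h1) (h2.congr fun n => (e2 n).symm)]
  congr 1
  · simp only [Int.natAbs_natCast]
    rw [← h1.sum_add_tsum_nat_add (k + 1)]
    congr 1
    · refine Finset.sum_congr rfl fun j hj => ?_
      have : j < k + 1 := by simpa using hj
      rw [show ((k : ℤ) - j).natAbs = k - j by omega]
    · refine tsum_congr fun n => ?_
      rw [show ((k : ℤ) - ((n + (k + 1) : ℕ) : ℤ)).natAbs = n + 1 by omega,
        show n + (k + 1) = k + n + 1 by omega]

theorem weight_le_weight {s : ℝ} (hs : 0 ≤ s) {j k : ℕ} (h : j ≤ k) : weight s j ≤ weight s k := by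
  rw [weight_eq_max, weight_eq_max]
  have : (j : ℝ) ≤ k := by exact_mod_cast h
  exact Real.rpow_le_rpow (by positivity) (max_le_max this le_rfl) hs

theorem weight_succ (s : ℝ) (n : ℕ) : weight s (n + 1) = ((n + 1 : ℕ) : ℝ) ^ s := by
  simp [weight]

/-- The part of the convolution constant that comes from the indices `0 ≤ j ≤ k`. -/
def convFinite (s : ℝ) (k : ℕ) : ℝ :=
  ∑ j ∈ Finset.range (k + 1), weight s k / (weight s j * weight s (k - j))

/-- In each infinite range the factor of index `k + n + 1` supplies `1 / ω_k^s`, and the other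
factor sums to at most `zetaBound s L`. The finite range is `convFinite` by definition. -/
theorem abs_conv_le {s : ℝ} (hs : 1 < s) {L : ℕ} (hL : 1 ≤ L) (x y : Omega s) (k : ℕ) :
    |conv x y k| ≤ (convFinite s k + 2 * zetaBound s L) * ‖x‖ * ‖y‖ / weight s k := by
  have hw := weight_pos s k
  have hxy : ∀ i j, |x i * y j| ≤ ‖x‖ * ‖y‖ / (weight s i * weight s j) := fun i j => by
    rw [abs_mul, ← div_mul_div_comm]
    exact mul_le_mul (x.abs_le s i) (y.abs_le s j) (abs_nonneg _)
      (div_nonneg (norm_nonneg _) (weight_pos s i).le)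
  have hnn : 0 ≤ ‖x‖ * ‖y‖ := by positivity
  have hsum := (summable_inv_succ_rpow hs).hasSum.mul_left (‖x‖ * ‖y‖ / weight s k)
  have hterm : ∀ n : ℕ, ‖x‖ * ‖y‖ / (weight s (n + 1) * weight s (k + n + 1)) ≤
      ‖x‖ * ‖y‖ / weight s k * (1 / ((n + 1 : ℕ) : ℝ) ^ s) := fun n => by
    rw [← weight_succ, div_mul_div_comm, mul_one, mul_comm (weight s (n + 1))]
    have h1 := weight_le_weight (by linarith : 0 ≤ s) (by omega : k ≤ k + n + 1)
    have h2 := weight_pos s (n + 1)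
    gcongr
  have b1 : |∑' n : ℕ, x (k + n + 1) * y (n + 1)| ≤
      ‖x‖ * ‖y‖ / weight s k * ∑' n : ℕ, 1 / ((n + 1 : ℕ) : ℝ) ^ s :=
    tsum_of_norm_bounded (f := fun n => x (k + n + 1) * y (n + 1)) hsum fun n =>
      (hxy (k + n + 1) (n + 1)).trans (by
        rw [mul_comm (weight s (k + n + 1))]
        exact hterm n)
  have b2 : |∑' n : ℕ, x (n + 1) * y (k + n + 1)| ≤
      ‖x‖ * ‖y‖ / weight s k * ∑' n : ℕ, 1 / ((n + 1 : ℕ) : ℝ) ^ s :=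
    tsum_of_norm_bounded (f := fun n => x (n + 1) * y (k + n + 1)) hsum fun n =>
      (hxy (n + 1) (k + n + 1)).trans (hterm n)
  have b3 : |∑ j ∈ Finset.range (k + 1), x j * y (k - j)| ≤
      ‖x‖ * ‖y‖ / weight s k * convFinite s k := by
    refine (Finset.abs_sum_le_sum_abs _ _).trans ?_
    unfold convFinite
    rw [Finset.mul_sum]
    refine Finset.sum_le_sum fun j _ => (hxy _ _).trans (le_of_eq ?_)
    field_simp
  have b4 := mul_le_mul_of_nonneg_left (tsum_inv_succ_rpow_le hs hL)
    (div_nonneg hnn hw.le : 0 ≤ ‖x‖ * ‖y‖ / weight s k)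
  rw [conv_eq hs x.seq_mem y.seq_mem]
  refine (abs_add_three _ _ _).trans ?_
  have : (convFinite s k + 2 * zetaBound s L) * ‖x‖ * ‖y‖ / weight s k =
      ‖x‖ * ‖y‖ / weight s k * convFinite s k +
      2 * (‖x‖ * ‖y‖ / weight s k * zetaBound s L) := by ring
  linarith

theorem convFinite_of_pos (s : ℝ) {k : ℕ} (hk : 1 ≤ k) :
    convFinite s k =
      2 + ∑ l ∈ Finset.Icc 1 (k - 1), (k : ℝ) ^ s / ((l : ℝ) ^ s * ((k : ℝ) - l) ^ s) := by
  have hw := (weight_pos s k).ne'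
  unfold convFinite
  rw [Finset.sum_range_succ, Finset.range_eq_Ico, Finset.sum_eq_sum_Ico_succ_bot (by omega),
    Nat.sub_self, Nat.sub_zero, zero_add]
  have e0 : weight s 0 = 1 := by simp [weight]
  have e : ∑ l ∈ Finset.Ico 1 k, weight s k / (weight s l * weight s (k - l)) =
      ∑ l ∈ Finset.Icc 1 (k - 1), (k : ℝ) ^ s / ((l : ℝ) ^ s * ((k : ℝ) - l) ^ s) := by
    rw [← Finset.Ico_add_one_right_eq_Icc, Nat.sub_add_cancel hk]
    refine Finset.sum_congr rfl fun l hl => ?_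
    obtain ⟨h1, h2⟩ := Finset.mem_Ico.1 hl
    unfold weight
    rw [if_neg (by omega), if_neg (by omega), if_neg (by omega), Nat.cast_sub h2.le]
  rw [e0, one_mul, mul_one, div_self hw, e]
  ring

theorem convFinite_add_eq_alpha (s : ℝ) (L : ℕ) {m k : ℕ} (hk : k < m) :
    convFinite s k + 2 * zetaBound s L = alpha s L m k := by
  unfold alpha zetaBound
  have : 2 / ((s - 1) * (L : ℝ) ^ (s - 1)) = 2 * (1 / ((s - 1) * (L : ℝ) ^ (s - 1))) := by ring
  split_ifs with h0
  · subst h0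
    rw [this]
    simp [convFinite, weight]
    ring
  · rw [convFinite_of_pos s (by omega), this]
    ring

theorem sum_Icc_reflect (f : ℕ → ℝ) (k : ℕ) :
    ∑ l ∈ Finset.Icc 2 (k - 2), f (k - l) = ∑ l ∈ Finset.Icc 2 (k - 2), f l := by
  refine Finset.sum_nbij' (fun l => k - l) (fun l => k - l) ?_ ?_ ?_ ?_ ?_
  all_goals intro l hl; have := Finset.mem_Icc.1 hl
  · exact Finset.mem_Icc.2 (by omega)
  · exact Finset.mem_Icc.2 (by omega)
  · omega
  · omega
  · rfl

theorem sum_Icc_two_inv_sq_le (n : ℕ) :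
    ∑ l ∈ Finset.Icc 2 n, 1 / (l : ℝ) ^ 2 ≤ Real.pi ^ 2 / 6 - 1 := by
  have h := sum_le_hasSum (insert 1 (Finset.Icc 2 n)) (fun i _ => by positivity) hasSum_zeta_two
  rw [Finset.sum_insert (by simp)] at h
  norm_num at h ⊢
  linarith

theorem sum_Icc_two_inv_le_log {n : ℕ} (hn : 1 ≤ n) :
    ∑ l ∈ Finset.Icc 2 n, 1 / (l : ℝ) ≤ Real.log n := by
  induction n, hn using Nat.le_induction with
  | base => simp
  | succ n hn ih =>
    rw [Finset.sum_Icc_succ_top (by omega)]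
    have hn0 : (0 : ℝ) < n := by exact_mod_cast hn
    have h1 := Real.log_le_sub_one_of_pos (div_pos hn0 (by linarith : (0 : ℝ) < n + 1))
    rw [Real.log_div (by linarith) (by linarith)] at h1
    have h2 : (n : ℝ) / (n + 1) - 1 = -(1 / (n + 1)) := by field_simp; ring
    push_cast
    linarith

/-- The increment of `log (k - 2)` is at most `1 / (k - 2)`, so a step decreases once `k / (k - 2) ≤
log (k - 2)`. This criterion holds from `k = 7` on, since `7/5 ≤ log 5`, but fails at `k = 6`. -/
theorem log_sub_two_div_antitone {m k : ℕ} (hm : 6 ≤ m) (hk : m ≤ k) :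
    Real.log ((k : ℝ) - 2) / k ≤ Real.log ((m : ℝ) - 2) / m := by
  induction k, hk using Nat.le_induction with
  | base => exact le_rfl
  | succ k hk ih =>
    refine le_trans ?_ ih
    have hk6 : 6 ≤ k := hm.trans hk
    have hk' : (6 : ℝ) ≤ k := by exact_mod_cast hk6
    rw [div_le_div_iff₀ (by positivity) (by positivity)]
    rcases hk6.eq_or_lt with rfl | h7
    · norm_num
      -- The step from 6 to 7 is the narrow inequality `5^6 = 15625 ≤ 16384 = 4^7`.
      have h1 : Real.log ((5 : ℝ) ^ 6) ≤ Real.log ((4 : ℝ) ^ 7) :=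
        Real.log_le_log (by norm_num) (by norm_num)
      rw [Real.log_pow, Real.log_pow] at h1
      norm_num at h1
      linarith
    · have h7' : (7 : ℝ) ≤ k := by exact_mod_cast h7
      push_cast
      have h1 : Real.log ((k : ℝ) + 1 - 2) ≤ Real.log ((k : ℝ) - 2) + 1 / (k - 2) := by
        have h2 := Real.log_le_sub_one_of_pos
          (div_pos (by linarith : (0 : ℝ) < k + 1 - 2) (by linarith : (0 : ℝ) < k - 2))
        rw [Real.log_div (by linarith) (by linarith)] at h2
        have h3 : ((k : ℝ) + 1 - 2) / (k - 2) - 1 = 1 / (k - 2) := by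
          have : (k : ℝ) - 2 ≠ 0 := by linarith
          field_simp; ring
        linarith
      have h5 : 7 / 5 ≤ Real.log 5 := by
        have h6 : Real.log (Real.exp 7) ≤ Real.log ((5 : ℝ) ^ 5) := by
          refine Real.log_le_log (Real.exp_pos _) ?_
          have h8 : Real.exp 7 = Real.exp 1 ^ 7 := by rw [← Real.exp_nat_mul]; norm_num
          rw [h8]
          calc Real.exp 1 ^ 7 ≤ 2.7182818286 ^ 7 := by
                gcongr
                exact Real.exp_one_lt_d9.le
            _ ≤ 5 ^ 5 := by norm_num
        rw [Real.log_exp, Real.log_pow] at h6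
        norm_num at h6
        linarith
      have h6 : Real.log 5 ≤ Real.log ((k : ℝ) - 2) :=
        Real.log_le_log (by norm_num) (by linarith)
      have h8 : (k : ℝ) * (1 / (k - 2)) ≤ 7 / 5 := by
        rw [mul_one_div, div_le_div_iff₀ (by linarith) (by norm_num)]
        linarith
      have h9 := mul_le_mul_of_nonneg_right h1 (by linarith : (0 : ℝ) ≤ k)
      linarith

/-- By partial fractions `k / (l (k - l)) = 1/l + 1/(k - l)`. In the square, the pure terms are
controlled by `ζ(2) - 1` twice; the cross term, split once more, gives `4/k` times a harmonic sum.
-/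
theorem sum_Icc_two_sq_le {k : ℕ} (hk : 6 ≤ k) :
    ∑ l ∈ Finset.Icc 2 (k - 2), ((k : ℝ) / (l * ((k : ℝ) - l))) ^ 2 ≤
      4 * Real.log ((k : ℝ) - 2) / k + (Real.pi ^ 2 - 6) / 3 := by
  have hk0 : (6 : ℝ) ≤ k := by exact_mod_cast hk
  have e : ∀ l ∈ Finset.Icc 2 (k - 2), ((k : ℝ) / (l * ((k : ℝ) - l))) ^ 2 =
      1 / (l : ℝ) ^ 2 + 1 / ((k - l : ℕ) : ℝ) ^ 2 +
        2 / k * (1 / (l : ℝ) + 1 / ((k - l : ℕ) : ℝ)) := by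
    intro l hl
    obtain ⟨h1, h2⟩ := Finset.mem_Icc.1 hl
    have hl0 : (0 : ℝ) < l := by exact_mod_cast (by omega : 0 < l)
    have hkl : (0 : ℝ) < (k : ℝ) - l := by
      have : (l : ℝ) < k := by exact_mod_cast (by omega : l < k)
      linarith
    rw [Nat.cast_sub (by omega)]
    field_simp
    ring
  rw [Finset.sum_congr rfl e, Finset.sum_add_distrib, Finset.sum_add_distrib, ← Finset.mul_sum,
    Finset.sum_add_distrib, sum_Icc_reflect (fun l => 1 / (l : ℝ) ^ 2),
    sum_Icc_reflect (fun l => 1 / (l : ℝ))]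
  have h1 := sum_Icc_two_inv_sq_le (k - 2)
  have h2 := sum_Icc_two_inv_le_log (n := k - 2) (by omega)
  rw [Nat.cast_sub (by omega : 2 ≤ k)] at h2
  have h3 := mul_le_mul_of_nonneg_left h2 (by positivity : (0 : ℝ) ≤ 4 / k)
  push_cast at h3
  have e4 : 4 * Real.log ((k : ℝ) - 2) / k = 4 / k * Real.log ((k : ℝ) - 2) := by ring
  rw [e4]
  have e5 : ∀ S : ℝ, 2 / (k : ℝ) * (S + S) = 4 / k * S := fun S => by ring
  rw [e5]
  linarith

/-- The two end terms are kept exactly. In the middle the exponent is split as `2 + (s - 2)`: the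
square is summed, and the remaining power is bounded uniformly. -/
theorem sum_Icc_rpow_le {s : ℝ} (hs : 2 ≤ s) {k : ℕ} (hk : 6 ≤ k) :
    ∑ l ∈ Finset.Icc 1 (k - 1), (k : ℝ) ^ s / ((l : ℝ) ^ s * ((k : ℝ) - l) ^ s) ≤
      2 * ((k : ℝ) / ((k : ℝ) - 1)) ^ s +
      (4 * Real.log ((k : ℝ) - 2) / k + (Real.pi ^ 2 - 6) / 3) * (2 / (k : ℝ) + 1 / 2) ^ (s - 2) := by
  have hk0 : (6 : ℝ) ≤ k := by exact_mod_cast hk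
  have e : Finset.Icc 1 (k - 1) = insert 1 (insert (k - 1) (Finset.Icc 2 (k - 2))) := by
    ext l
    simp only [Finset.mem_Icc, Finset.mem_insert]
    omega
  rw [e, Finset.sum_insert (by simp; omega), Finset.sum_insert (by simp; omega)]
  have hmid : ∑ l ∈ Finset.Icc 2 (k - 2), (k : ℝ) ^ s / ((l : ℝ) ^ s * ((k : ℝ) - l) ^ s) ≤
      (4 * Real.log ((k : ℝ) - 2) / k + (Real.pi ^ 2 - 6) / 3) *
        (2 / (k : ℝ) + 1 / 2) ^ (s - 2) := by
    refine le_trans ?_ (mul_le_mul_of_nonneg_right (sum_Icc_two_sq_le hk) (by positivity))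
    rw [Finset.sum_mul]
    refine Finset.sum_le_sum fun l hl => ?_
    obtain ⟨h1, h2⟩ := Finset.mem_Icc.1 hl
    have hl2 : (2 : ℝ) ≤ l := by exact_mod_cast h1
    have hkl : (2 : ℝ) ≤ (k : ℝ) - l := by
      have : (l : ℝ) + 2 ≤ k := by exact_mod_cast (by omega : l + 2 ≤ k)
      linarith
    have hp : 0 < (k : ℝ) / (l * ((k : ℝ) - l)) := by
      have : 0 < (k : ℝ) - l := by linarith
      positivity
    rw [← Real.mul_rpow (by linarith) (by linarith), ← Real.div_rpow (by linarith) (by nlinarith)]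
    have e1 : ((k : ℝ) / (l * ((k : ℝ) - l))) ^ s =
        ((k : ℝ) / (l * ((k : ℝ) - l))) ^ 2 * ((k : ℝ) / (l * ((k : ℝ) - l))) ^ (s - 2) := by
      rw [← Real.rpow_natCast _ 2, ← Real.rpow_add hp]
      congr 1
      push_cast
      ring
    rw [e1]
    refine mul_le_mul_of_nonneg_left (Real.rpow_le_rpow hp.le ?_ (by linarith)) (by positivity)
    -- On the middle range `l (k - l) ≥ 2 (k - 2)`, because `(l - 2)(k - l - 2) ≥ 0`, and `k / (2 (k
    -- - 2)) ≤ (k + 4) / (2 k)` as soon as `k ≥ 4`.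
    have e2 : 2 / (k : ℝ) + 1 / 2 = (k + 4) / (2 * k) := by field_simp; ring
    rw [e2, div_le_div_iff₀ (by nlinarith) (by linarith)]
    nlinarith [mul_nonneg (by linarith : 0 ≤ (l : ℝ) - 2) (by linarith : 0 ≤ (k : ℝ) - l - 2)]
  have h1 : (k : ℝ) ^ s / (((1 : ℕ) : ℝ) ^ s * ((k : ℝ) - (1 : ℕ)) ^ s) =
      ((k : ℝ) / ((k : ℝ) - 1)) ^ s := by
    rw [Real.div_rpow (by linarith) (by linarith)]
    simp
  have h2 : (k : ℝ) ^ s / (((k - 1 : ℕ) : ℝ) ^ s * ((k : ℝ) - (k - 1 : ℕ)) ^ s) =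
      ((k : ℝ) / ((k : ℝ) - 1)) ^ s := by
    rw [Real.div_rpow (by linarith) (by linarith), Nat.cast_sub (by omega)]
    simp
  rw [h1, h2]
  linarith

/-- After `sum_Icc_rpow_le` every `k`-dependent piece is nonincreasing for `k ≥ m ≥ 6`, so its value
at `m` serves the whole tail. -/
theorem convFinite_add_le_alpha {s : ℝ} (hs : 2 ≤ s) (L : ℕ) {m k : ℕ} (hm : 6 ≤ m) (hk : m ≤ k) :
    convFinite s k + 2 * zetaBound s L ≤ alpha s L m m := by
  have hm0 : (6 : ℝ) ≤ m := by exact_mod_cast hm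
  have hk0 : (m : ℝ) ≤ k := by exact_mod_cast hk
  rw [convFinite_of_pos s (by omega)]
  have h1 := sum_Icc_rpow_le hs (hm.trans hk)
  have h2 : ((k : ℝ) / ((k : ℝ) - 1)) ^ s ≤ ((m : ℝ) / ((m : ℝ) - 1)) ^ s := by
    have : 0 < (k : ℝ) - 1 := by linarith
    refine Real.rpow_le_rpow (by positivity) ?_ (by linarith)
    rw [div_le_div_iff₀ (by linarith) (by linarith)]
    linarith
  have h3 : (2 / (k : ℝ) + 1 / 2) ^ (s - 2) ≤ (2 / (m : ℝ) + 1 / 2) ^ (s - 2) := by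
    refine Real.rpow_le_rpow (by positivity) ?_ (by linarith)
    gcongr
  have h4 := log_sub_two_div_antitone hm hk
  have h5 : 0 ≤ Real.log ((k : ℝ) - 2) := Real.log_nonneg (by linarith)
  have h6 : (0 : ℝ) ≤ (Real.pi ^ 2 - 6) / 3 := by nlinarith [Real.pi_gt_three]
  have h7 : (4 * Real.log ((k : ℝ) - 2) / k + (Real.pi ^ 2 - 6) / 3) *
      (2 / (k : ℝ) + 1 / 2) ^ (s - 2) ≤
      (4 * Real.log ((m : ℝ) - 2) / m + (Real.pi ^ 2 - 6) / 3) *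
      (2 / (m : ℝ) + 1 / 2) ^ (s - 2) := by
    rw [mul_div_assoc, mul_div_assoc] at *
    have h8 : 0 ≤ Real.log ((k : ℝ) - 2) / k := by positivity
    refine mul_le_mul (by linarith) h3 (by positivity) (by linarith)
  unfold alpha zetaBound
  rw [if_neg (by omega), if_neg (lt_irrefl m)]
  have : 2 / ((s - 1) * (L : ℝ) ^ (s - 1)) = 2 * (1 / ((s - 1) * (L : ℝ) ^ (s - 1))) := by ring
  rw [this]
  linarith

theorem abs_conv_le_head {s : ℝ} (hs : 1 < s) {L : ℕ} (hL : 1 ≤ L) (x y : Omega s) {m k : ℕ}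
    (hk : k < m) : |conv x y k| ≤ alpha s L m k * ‖x‖ * ‖y‖ / weight s k := by
  rw [← convFinite_add_eq_alpha s L hk]
  exact abs_conv_le hs hL x y k

theorem abs_conv_le_tail {s : ℝ} (hs : 2 ≤ s) {L : ℕ} (hL : 1 ≤ L) (x y : Omega s) {m k : ℕ}
    (hm : 6 ≤ m) (hk : m ≤ k) :
    |conv x y k| ≤ alpha s L m m * ‖x‖ * ‖y‖ / weight s k := by
  refine (abs_conv_le (by linarith) hL x y k).trans ?_
  have := weight_pos s k
  gcongr
  exact convFinite_add_le_alpha hs L hm hk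

theorem convFinite_add_nonneg {s : ℝ} (hs : 1 < s) (L k : ℕ) :
    0 ≤ convFinite s k + 2 * zetaBound s L := by
  have h1 : 0 ≤ convFinite s k := Finset.sum_nonneg fun j _ =>
    div_nonneg (weight_pos _ _).le (mul_pos (weight_pos _ _) (weight_pos _ _)).le
  have h2 : 0 ≤ zetaBound s L := by
    have : 0 < s - 1 := by linarith
    unfold zetaBound
    positivity
  positivity

/-- One factor lives on indices below `m`, the other on indices from `m` on. Since `k < m`, only the
range of negative `j` can put a small index on the first and a large one on the second, and there `m
- k ≤ l ≤ m - 1`. -/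
theorem abs_conv_dropHead_le {s : ℝ} (hs : 1 < s) {m k : ℕ} (xbar : Fin m → ℝ) (z : Omega s)
    (hk : k < m) :
    |conv (extendZero xbar) (dropHead m z) k| ≤
      (∑ l ∈ Finset.Icc (m - k) (m - 1), |extendZero xbar l| / weight s (k + l)) * ‖z‖ := by
  have hx0 : ∀ l, m ≤ l → extendZero xbar l = 0 := fun l hl => by
    unfold extendZero; rw [dif_neg (by omega)]
  have hz0 : ∀ l, l < m → dropHead m z l = 0 := fun l hl => by
    unfold dropHead; rw [if_pos hl]
  rw [conv_eq hs (extendZero_mem s xbar) (dropHead_mem z.seq_mem m)]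
  have e1 : ∑ j ∈ Finset.range (k + 1), extendZero xbar j * dropHead m z (k - j) = 0 :=
    Finset.sum_eq_zero fun j _ => by rw [hz0 _ (by omega), mul_zero]
  have e2 : ∑' n : ℕ, extendZero xbar (k + n + 1) * dropHead m z (n + 1) = 0 := by
    rw [← tsum_zero (α := ℝ) (β := ℕ)]
    refine tsum_congr fun n => ?_
    rcases lt_or_ge (n + 1) m with h | h
    · rw [hz0 _ h, mul_zero]
    · rw [hx0 _ (by omega), zero_mul]
  have e3 : ∑' n : ℕ, extendZero xbar (n + 1) * dropHead m z (k + n + 1) =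
      ∑ l ∈ Finset.Icc (m - k) (m - 1), extendZero xbar l * dropHead m z (k + l) := by
    rw [tsum_eq_sum (s := Finset.Ico (m - k - 1) (m - 1))]
    · have := Finset.sum_Ico_add' (fun l => extendZero xbar l * dropHead m z (k + l))
        (m - k - 1) (m - 1) 1
      rw [← Finset.Ico_add_one_right_eq_Icc, show m - k = m - k - 1 + 1 by omega, ← this]
      rfl
    · intro n hn
      rw [Finset.mem_Ico] at hn
      rcases lt_or_ge (n + 1) m with h | h
      · rw [hz0 _ (by omega), mul_zero]
      · rw [hx0 _ h, zero_mul]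
  rw [e1, e2, e3, zero_add, zero_add, Finset.sum_mul]
  refine (Finset.abs_sum_le_sum_abs _ _).trans (Finset.sum_le_sum fun l _ => ?_)
  rw [abs_mul, div_mul_eq_mul_div, mul_div_assoc]
  refine mul_le_mul_of_nonneg_left ?_ (abs_nonneg _)
  unfold dropHead
  split_ifs
  · rw [abs_zero]
    exact div_nonneg (norm_nonneg _) (weight_pos _ _).le
  · exact z.abs_le s _

/-! ### Geometric decay in the `LU` factors of the tail. -/

section Theta

variable {δ : ℝ}

theorem half_lt_gam (h0 : 0 < δ) (h1 : δ < 1 / 2) : 1 / 2 < gam δ := by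
  unfold gam
  have : 0 < Real.sqrt (1 / 4 - δ ^ 2) := Real.sqrt_pos.2 (by nlinarith)
  linarith

theorem gam_pos (h0 : 0 < δ) (h1 : δ < 1 / 2) : 0 < gam δ := by linarith [half_lt_gam h0 h1]

theorem gam_mul_theta (h0 : 0 < δ) (h1 : δ < 1 / 2) : gam δ * theta δ = δ :=
  mul_div_cancel₀ _ (gam_pos h0 h1).ne'

theorem theta_pos (h0 : 0 < δ) (h1 : δ < 1 / 2) : 0 < theta δ := div_pos h0 (gam_pos h0 h1)

theorem theta_lt_one (h0 : 0 < δ) (h1 : δ < 1 / 2) : theta δ < 1 := by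
  rw [theta, div_lt_one (gam_pos h0 h1)]
  linarith [half_lt_gam h0 h1]

/-- The quadratic equation for `γ`, divided by `γ`: it makes `γ` the fixed point of the recurrence
for the ratios `|δ_{n+1}| / (|μ_{m+n}| |δ_n|)`. -/
theorem one_sub_mul_theta (h0 : 0 < δ) (h1 : δ < 1 / 2) : 1 - δ * theta δ = gam δ := by
  have hg := gam_pos h0 h1
  have hq : gam δ ^ 2 - gam δ + δ ^ 2 = 0 := by
    have : Real.sqrt (1 / 4 - δ ^ 2) ^ 2 = 1 / 4 - δ ^ 2 := Real.sq_sqrt (by nlinarith)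
    unfold gam
    nlinarith
  rw [theta]
  field_simp
  linarith

end Theta

/-- The `n`-th rows, `n ≥ m`, of the tridiagonal operator are diagonally dominant. -/
structure TailDominant (lam mu bet : ℕ → ℝ) (δ : ℝ) (m : ℕ) : Prop where
  pos : 0 < δ
  lt_half : δ < 1 / 2
  mu_pos : ∀ n, 0 < |mu (m + n)|
  lam_le : ∀ n, |lam (m + n)| ≤ δ * |mu (m + n)|
  bet_le : ∀ n, |bet (m + n)| ≤ δ * |mu (m + n)|

theorem TridiagAssumptions.tailDominant {lam mu bet : ℕ → ℝ} {sL C₁ C₂ δ : ℝ} {k₀ : ℕ}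
    (hT : TridiagAssumptions lam mu bet sL C₁ C₂ δ k₀) {m : ℕ} (hm : k₀ ≤ m) :
    TailDominant lam mu bet δ m := by
  have hmu : ∀ n, 0 < |mu (m + n)| := fun n => by
    have h := hT.C₁_pos.trans_le (hT.le_mu (m + n) (by omega))
    refine abs_pos.2 fun h0 => ?_
    simp [h0] at h
  refine ⟨hT.δ_pos, hT.δ_lt_half, hmu, fun n => ?_, fun n => ?_⟩
  · have := hT.lam_div_mu (m + n) (by omega)
    rwa [abs_div, div_le_iff₀ (hmu n)] at this
  · have := hT.bet_div_mu (m + n) (by omega)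
    rwa [abs_div, div_le_iff₀ (hmu n)] at this

namespace TailDominant

variable {lam mu bet : ℕ → ℝ} {δ : ℝ} {m : ℕ}

/-- By induction the subtracted term of the recurrence is at most `δθ |μ_{m+n+1}| |δ_{n+1}|`,
leaving the fraction `1 - δθ = γ`. Positivity is carried along since it is needed for the next step
and for all later divisions. -/
theorem del_aux (h : TailDominant lam mu bet δ m) (n : ℕ) :
    gam δ * |mu (m + n)| * |del lam mu bet m n| ≤ |del lam mu bet m (n + 1)| ∧
      0 < |del lam mu bet m n| := by
  have hg := gam_pos h.pos h.lt_half
  have hθ := theta_pos h.pos h.lt_half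
  induction n with
  | zero =>
    refine ⟨?_, by simp [del]⟩
    have : gam δ ≤ 1 := by
      rw [← one_sub_mul_theta h.pos h.lt_half]
      linarith [mul_pos h.pos hθ]
    simpa [del] using mul_le_mul_of_nonneg_right this (abs_nonneg (mu m))
  | succ n ih =>
    obtain ⟨ih1, ih2⟩ := ih
    have hpos : 0 < |del lam mu bet m (n + 1)| :=
      (mul_pos (mul_pos hg (h.mu_pos n)) ih2).trans_le ih1
    refine ⟨?_, hpos⟩
    have hb : |bet (m + n)| * |del lam mu bet m n| ≤ theta δ * |del lam mu bet m (n + 1)| := by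
      calc |bet (m + n)| * |del lam mu bet m n| ≤ δ * |mu (m + n)| * |del lam mu bet m n| := by
            gcongr; exact h.bet_le n
        _ = theta δ * (gam δ * |mu (m + n)| * |del lam mu bet m n|) := by
            nth_rewrite 1 [← gam_mul_theta h.pos h.lt_half]
            ring
        _ ≤ _ := by gcongr
    have e : del lam mu bet m (n + 1 + 1) = mu (m + (n + 1)) * del lam mu bet m (n + 1) -
      lam (m + (n + 1)) * bet (m + n) * del lam mu bet m n := rfl
    have hl : |lam (m + (n + 1)) * bet (m + n) * del lam mu bet m n| ≤
        δ * |mu (m + (n + 1))| * (theta δ * |del lam mu bet m (n + 1)|) := by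
      rw [mul_assoc, abs_mul, abs_mul]
      exact mul_le_mul (h.lam_le _) hb (by positivity)
        (mul_nonneg h.pos.le (abs_nonneg _))
    have := abs_sub_abs_le_abs_sub (mu (m + (n + 1)) * del lam mu bet m (n + 1))
      (lam (m + (n + 1)) * bet (m + n) * del lam mu bet m n)
    rw [e]
    rw [abs_mul] at this
    nth_rewrite 1 [← one_sub_mul_theta h.pos h.lt_half]
    linarith

theorem abs_del_pos (h : TailDominant lam mu bet δ m) (n : ℕ) : 0 < |del lam mu bet m n| :=
  (h.del_aux n).2

theorem abs_del_succ_ge (h : TailDominant lam mu bet δ m) (n : ℕ) :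
    gam δ * |mu (m + n)| * |del lam mu bet m n| ≤ |del lam mu bet m (n + 1)| :=
  (h.del_aux n).1

theorem mul_del_le (h : TailDominant lam mu bet δ m) {x : ℝ} {n : ℕ}
    (hx : |x| ≤ δ * |mu (m + n)|) :
    |x| * |del lam mu bet m n| ≤ theta δ * |del lam mu bet m (n + 1)| := by
  have hθ := theta_pos h.pos h.lt_half
  calc |x| * |del lam mu bet m n| ≤ δ * |mu (m + n)| * |del lam mu bet m n| := by gcongr
    _ = theta δ * (gam δ * |mu (m + n)| * |del lam mu bet m n|) := by
        nth_rewrite 1 [← gam_mul_theta h.pos h.lt_half]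
        ring
    _ ≤ _ := by gcongr; exact h.abs_del_succ_ge n

theorem prod_bet_mul_del_le (h : TailDominant lam mu bet δ m) (k l : ℕ) :
    (∏ i ∈ Finset.Icc (k + 1) (k + l), |bet (m + (i - 1))|) * |del lam mu bet m k| ≤
      theta δ ^ l * |del lam mu bet m (k + l)| := by
  have hθ := theta_pos h.pos h.lt_half
  induction l with
  | zero => simp
  | succ l ih =>
    rw [← add_assoc, Finset.prod_Icc_succ_top (by omega)]
    have e : m + (k + l + 1 - 1) = m + (k + l) := by omega
    rw [e]
    calc _ = |bet (m + (k + l))| *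
          ((∏ i ∈ Finset.Icc (k + 1) (k + l), |bet (m + (i - 1))|) * |del lam mu bet m k|) := by
          ring
      _ ≤ |bet (m + (k + l))| * (theta δ ^ l * |del lam mu bet m (k + l)|) := by gcongr
      _ = theta δ ^ l * (|bet (m + (k + l))| * |del lam mu bet m (k + l)|) := by ring
      _ ≤ theta δ ^ l * (theta δ * |del lam mu bet m (k + l + 1)|) := by
          gcongr ?_ * ?_
          exact h.mul_del_le (h.bet_le _)
      _ = _ := by ring

/-- The product starts at `λ_{m+j+1}`, one place later than its counterpart for `bet`, so it
telescopes against `δ_{j+1}`. The unused step from `δ_j` to `δ_{j+1}` pays for the diagonal factor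
`γ |μ_{m+j}|` in `Linv_term_le`. -/
theorem prod_lam_mul_del_le (h : TailDominant lam mu bet δ m) (j p : ℕ) :
    (∏ i ∈ Finset.Icc (j + 2) (j + p + 1), |lam (m + (i - 1))|) * |del lam mu bet m (j + 1)| ≤
      theta δ ^ p * |del lam mu bet m (j + p + 1)| := by
  have hθ := theta_pos h.pos h.lt_half
  induction p with
  | zero => simp
  | succ p ih =>
    rw [← add_assoc, Finset.prod_Icc_succ_top (by omega)]
    have e : m + (j + p + 1 + 1 - 1) = m + (j + p + 1) := by omega
    rw [e]
    calc _ = |lam (m + (j + p + 1))| *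
          ((∏ i ∈ Finset.Icc (j + 2) (j + p + 1), |lam (m + (i - 1))|) *
            |del lam mu bet m (j + 1)|) := by ring
      _ ≤ |lam (m + (j + p + 1))| * (theta δ ^ p * |del lam mu bet m (j + p + 1)|) := by gcongr
      _ = theta δ ^ p * (|lam (m + (j + p + 1))| * |del lam mu bet m (j + p + 1)|) := by ring
      _ ≤ theta δ ^ p * (theta δ * |del lam mu bet m (j + p + 1 + 1)|) := by
          gcongr ?_ * ?_
          exact h.mul_del_le (h.lam_le _)
      _ = _ := by ring

theorem Linv_term_le (h : TailDominant lam mu bet δ m) {y B : ℕ → ℝ}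
    (hB : ∀ j, |y j| ≤ gam δ * |mu (m + j)| * B j) (hB0 : ∀ j, 0 ≤ B j) (j p : ℕ) :
    |(-1) ^ p * (∏ i ∈ Finset.Icc (j + 2) (j + p + 1), lam (m + (i - 1))) *
      (del lam mu bet m j / del lam mu bet m (j + p)) * y j| * |del lam mu bet m (j + p)| ≤
      theta δ ^ p * B j * |del lam mu bet m (j + p + 1)| := by
  have hθ := theta_pos h.pos h.lt_half
  have hd := h.abs_del_pos (j + p)
  simp only [abs_mul, abs_div, abs_pow, abs_neg, abs_one, one_pow, one_mul, Finset.abs_prod]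
  have hP := h.prod_lam_mul_del_le j p
  have hP0 : 0 ≤ ∏ i ∈ Finset.Icc (j + 2) (j + p + 1), |lam (m + (i - 1))| :=
    Finset.prod_nonneg fun _ _ => abs_nonneg _
  set P := ∏ i ∈ Finset.Icc (j + 2) (j + p + 1), |lam (m + (i - 1))|
  calc P * (|del lam mu bet m j| / |del lam mu bet m (j + p)|) * |y j| *
        |del lam mu bet m (j + p)| = P * (|del lam mu bet m j| * |y j|) := by field_simp
    _ ≤ P * (|del lam mu bet m j| * (gam δ * |mu (m + j)| * B j)) := by
        gcongr
        exact hB j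
    _ = P * (gam δ * |mu (m + j)| * |del lam mu bet m j| * B j) := by ring
    _ ≤ P * (|del lam mu bet m (j + 1)| * B j) :=
        mul_le_mul_of_nonneg_left
          (mul_le_mul_of_nonneg_right (h.abs_del_succ_ge j) (hB0 j)) hP0
    _ = P * |del lam mu bet m (j + 1)| * B j := by ring
    _ ≤ (theta δ ^ p * |del lam mu bet m (j + p + 1)|) * B j :=
        mul_le_mul_of_nonneg_right hP (hB0 j)
    _ = _ := by ring

/-- Data are measured against `γ |μ_{m+j}|` through `B`. The ratio `|δ_{k+1}| / |δ_k|` is left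
uncancelled, because it is the diagonal entry that `U_I⁻¹` divides out in `UinvTerm_le`. -/
theorem Linv_le (h : TailDominant lam mu bet δ m) {y B : ℕ → ℝ}
    (hB : ∀ j, |y j| ≤ gam δ * |mu (m + j)| * B j) (hB0 : ∀ j, 0 ≤ B j) (k : ℕ) :
    |Linv lam mu bet m y k| * |del lam mu bet m k| ≤
      (∑ j ∈ Finset.range (k + 1), theta δ ^ (k - j) * B j) * |del lam mu bet m (k + 1)| := by
  have hd := h.abs_del_pos k
  have e : Linv lam mu bet m y k = ∑ j ∈ Finset.range (k + 1), (-1) ^ (k - j) *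
      (∏ i ∈ Finset.Icc (j + 2) (j + (k - j) + 1), lam (m + (i - 1))) *
      (del lam mu bet m j / del lam mu bet m (j + (k - j))) * y j := by
    -- Reindexing by `j = k - l`; the isolated term `y k` becomes the summand `j = k`.
    rw [← Finset.sum_range_reflect, Finset.sum_range_succ', add_comm, Linv]
    congr 1
    · have hk : del lam mu bet m k ≠ 0 := abs_pos.1 hd
      simp [hk]
    · rw [← Finset.Ico_add_one_right_eq_Icc, Finset.sum_Ico_eq_sum_range]
      refine Finset.sum_congr (by simp) fun i hi => ?_
      have hi : i < k := by simpa using hi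
      have e1 : k + 1 - 1 - (i + 1) = k - (1 + i) := by omega
      have e2 : k - (k - (1 + i)) = 1 + i := by omega
      have e3 : k - (1 + i) + (1 + i) = k := by omega
      rw [e1, e2, e3]
  rw [e, Finset.sum_mul]
  refine (mul_le_mul_of_nonneg_right (Finset.abs_sum_le_sum_abs _ _) hd.le).trans ?_
  rw [Finset.sum_mul]
  refine Finset.sum_le_sum fun j hj => ?_
  have hj : j ≤ k := by simpa [Nat.lt_succ_iff] using hj
  have := h.Linv_term_le hB hB0 j (k - j)
  rw [Nat.add_sub_cancel' hj] at this ⊢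
  exact this

theorem UinvTerm_le (h : TailDominant lam mu bet δ m) {y B : ℕ → ℝ}
    (hB : ∀ j, |y j| ≤ gam δ * |mu (m + j)| * B j) (hB0 : ∀ j, 0 ≤ B j) (k l : ℕ) :
    |UinvTerm lam mu bet m (Linv lam mu bet m y) k l| ≤
      theta δ ^ l * ∑ j ∈ Finset.range (k + l + 1), theta δ ^ (k + l - j) * B j := by
  have hθ := theta_pos h.pos h.lt_half
  have hd := h.abs_del_pos (k + l + 1)
  unfold UinvTerm
  simp only [abs_mul, abs_div, abs_pow, abs_neg, abs_one, one_pow, one_mul, Finset.abs_prod]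
  have h1 := h.prod_bet_mul_del_le k l
  have h2 := h.Linv_le hB hB0 (k + l)
  set P := ∏ i ∈ Finset.Icc (k + 1) (k + l), |bet (m + (i - 1))|
  set S := ∑ j ∈ Finset.range (k + l + 1), theta δ ^ (k + l - j) * B j
  have : |del lam mu bet m k| / |del lam mu bet m (k + l + 1)| * P *
      |Linv lam mu bet m y (k + l)| =
      (P * |del lam mu bet m k| * |Linv lam mu bet m y (k + l)|) /
        |del lam mu bet m (k + l + 1)| := by ring
  rw [this, div_le_iff₀ hd]
  calc P * |del lam mu bet m k| * |Linv lam mu bet m y (k + l)|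
      ≤ theta δ ^ l * |del lam mu bet m (k + l)| * |Linv lam mu bet m y (k + l)| := by gcongr
    _ = theta δ ^ l * (|Linv lam mu bet m y (k + l)| * |del lam mu bet m (k + l)|) := by ring
    _ ≤ theta δ ^ l * (S * |del lam mu bet m (k + l + 1)|) := by gcongr
    _ = _ := by ring

end TailDominant

/-! ### Summing the double geometric series. -/

theorem hasSum_geometric_majorant {θ : ℝ} (h0 : 0 < θ) (h1 : θ < 1) (a b : ℝ) :
    HasSum (fun l : ℕ => θ ^ l * (θ ^ l * a + b * ((1 - θ ^ l) / (1 - θ))))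
      (1 / (1 - θ ^ 2) * (a + b * (θ / (1 - θ)))) := by
  have h2 : θ ^ 2 < 1 := by nlinarith
  have g1 := hasSum_geometric_of_lt_one h0.le h1
  have g2 := hasSum_geometric_of_lt_one (sq_nonneg θ) h2
  have hne : 1 - θ ≠ 0 := by linarith
  have hne' : 1 + θ ≠ 0 := by linarith
  have := (g2.mul_left (a - b / (1 - θ))).add (g1.mul_left (b / (1 - θ)))
  have e2 : 1 - θ ^ 2 = (1 - θ) * (1 + θ) := by ring
  rw [e2] at this ⊢
  have e3 : (fun l : ℕ => θ ^ l * (θ ^ l * a + b * ((1 - θ ^ l) / (1 - θ)))) =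
      fun l => (a - b / (1 - θ)) * (θ ^ 2) ^ l + b / (1 - θ) * θ ^ l := by
    funext l
    rw [← pow_mul, mul_comm 2 l, pow_mul]
    field_simp
    ring
  have e4 : 1 / ((1 - θ) * (1 + θ)) * (a + b * (θ / (1 - θ))) =
      (a - b / (1 - θ)) * ((1 - θ) * (1 + θ))⁻¹ + b / (1 - θ) * (1 - θ)⁻¹ := by
    field_simp
    ring
  rw [e3, e4]
  exact this

/-- Terms with `j ≤ k` acquire the common factor `θ^l`; the `l` later ones are at most `b (1 + θ + ⋯
+ θ^{l-1})`. -/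
theorem sum_range_add_le {θ b : ℝ} (h0 : 0 < θ) (h1 : θ < 1) {B : ℕ → ℝ} {k : ℕ}
    (hb : ∀ j, k < j → B j ≤ b) (l : ℕ) :
    ∑ j ∈ Finset.range (k + l + 1), θ ^ (k + l - j) * B j ≤
      θ ^ l * (∑ j ∈ Finset.range (k + 1), θ ^ (k - j) * B j) + b * ((1 - θ ^ l) / (1 - θ)) := by
  have hne : 1 - θ ≠ 0 := by linarith
  induction l with
  | zero => simp
  | succ l ih =>
    rw [← add_assoc, Finset.sum_range_succ]
    have e : ∑ j ∈ Finset.range (k + l + 1), θ ^ (k + l + 1 - j) * B j =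
        θ * ∑ j ∈ Finset.range (k + l + 1), θ ^ (k + l - j) * B j := by
      rw [Finset.mul_sum]
      refine Finset.sum_congr rfl fun j hj => ?_
      have : j ≤ k + l := by simpa [Nat.lt_succ_iff] using hj
      rw [Nat.sub_add_comm this]
      ring
    rw [e]
    have h2 := mul_le_mul_of_nonneg_left ih h0.le
    have h3 := hb (k + l + 1) (by omega)
    have e2 : b * ((1 - θ ^ (l + 1)) / (1 - θ)) = θ * (b * ((1 - θ ^ l) / (1 - θ))) + b := by
      field_simp
      ring
    rw [e2, Nat.sub_self, pow_zero, one_mul, pow_succ]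
    linarith

namespace TailDominant

variable {lam mu bet : ℕ → ℝ} {δ : ℝ} {m : ℕ}

theorem UinvTerm_le_majorant (h : TailDominant lam mu bet δ m) {y B : ℕ → ℝ}
    (hB : ∀ j, |y j| ≤ gam δ * |mu (m + j)| * B j) (hB0 : ∀ j, 0 ≤ B j) {k : ℕ} {b : ℝ}
    (hb : ∀ j, k < j → B j ≤ b) (l : ℕ) :
    ‖UinvTerm lam mu bet m (Linv lam mu bet m y) k l‖ ≤
      theta δ ^ l * (theta δ ^ l * (∑ j ∈ Finset.range (k + 1), theta δ ^ (k - j) * B j) +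
        b * ((1 - theta δ ^ l) / (1 - theta δ))) := by
  have hθ := theta_pos h.pos h.lt_half
  refine (h.UinvTerm_le hB hB0 k l).trans ?_
  gcongr
  exact sum_range_add_le hθ (theta_lt_one h.pos h.lt_half) hb l

theorem uLinvConverges (h : TailDominant lam mu bet δ m) {y B : ℕ → ℝ}
    (hB : ∀ j, |y j| ≤ gam δ * |mu (m + j)| * B j) (hB0 : ∀ j, 0 ≤ B j)
    (hb : ∃ b, ∀ j, B j ≤ b) : ULinvConverges lam mu bet m y := by
  obtain ⟨b, hb⟩ := hb
  exact fun k => Summable.of_norm_bounded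
    (hasSum_geometric_majorant (theta_pos h.pos h.lt_half) (theta_lt_one h.pos h.lt_half) _ b).summable
    (h.UinvTerm_le_majorant hB hB0 fun j _ => hb j)

theorem abs_ULinv_le (h : TailDominant lam mu bet δ m) {y B : ℕ → ℝ}
    (hB : ∀ j, |y j| ≤ gam δ * |mu (m + j)| * B j) (hB0 : ∀ j, 0 ≤ B j) {k : ℕ} {b : ℝ}
    (hb : ∀ j, k < j → B j ≤ b) :
    |ULinv lam mu bet m y k| ≤ 1 / (1 - theta δ ^ 2) *
      ((∑ j ∈ Finset.range (k + 1), theta δ ^ (k - j) * B j) +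
        b * (theta δ / (1 - theta δ))) :=
  tsum_of_norm_bounded
    (hasSum_geometric_majorant (theta_pos h.pos h.lt_half) (theta_lt_one h.pos h.lt_half) _ b)
    (h.UinvTerm_le_majorant hB hB0 hb)

end TailDominant

/-! ### The constant `χ` and the conditions on `M`. -/

/-- With `q = -log θ / 2`, the first entry of the maximum is the larger root of `q X (X + m) - (s +
s_L + 1) X - m`, so this quadratic is nonnegative at `M`. The second entry says `1 / q ≤ √M`. -/
theorem CondMA.of_nonneg {θ : ℝ} (h0 : 0 < θ) (h1 : θ < 1) {m M : ℕ} {s sL : ℝ}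
    (h : CondMA θ m M s sL) :
    (s + sL + 1) * M + m ≤ -(Real.log θ / 2) * (M * (M + m)) ∧
      2 / -Real.log θ ≤ Real.sqrt M ∧ m ≤ M := by
  have hlog : Real.log θ < 0 := Real.log_neg h0 h1
  obtain ⟨h2, h3⟩ := max_le_iff.1 h
  obtain ⟨h2, h4⟩ := max_le_iff.1 h2
  refine ⟨?_, ?_, by exact_mod_cast h3⟩
  · rw [Real.log_sqrt h0.le] at h2
    obtain ⟨q, hq⟩ : ∃ q, q = -(Real.log θ / 2) := ⟨_, rfl⟩
    have hl : Real.log θ / 2 = -q := by rw [hq]; ring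
    have hq0 : 0 < q := by rw [hq]; linarith
    rw [hl] at h2
    rw [← hq]
    set R := Real.sqrt (((m : ℝ) * -q + s + sL + 1) ^ 2 - 4 * m * -q) with hR
    have hR0 : 0 ≤ R := Real.sqrt_nonneg _
    have hm0 : (0 : ℝ) ≤ m := Nat.cast_nonneg m
    have hR2 : R ^ 2 = ((m : ℝ) * -q + s + sL + 1) ^ 2 - 4 * m * -q :=
      Real.sq_sqrt (by nlinarith [mul_nonneg hm0 hq0.le, sq_nonneg ((m : ℝ) * -q + s + sL + 1)])
    rw [div_le_iff_of_neg (by linarith)] at h2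
    -- Both sides are nonnegative, so squaring completes the square backwards: the difference is
    -- `4q` times the quadratic at `M`.
    have h5 : R ≤ 2 * q * M + m * q - (s + sL + 1) := by linarith
    have h6 := pow_le_pow_left₀ hR0 h5 2
    rw [hR2] at h6
    have h7 : 0 ≤ 4 * q * (q * (M * (M + m)) - ((s + sL + 1) * M + m)) := by nlinarith
    have h8 := nonneg_of_mul_nonneg_right h7 (by positivity)
    linarith
  · refine Real.le_sqrt_of_sq_le ?_
    rw [div_pow, neg_sq]
    norm_num
    exact h4

/-- With `E = exp (-a)`, `a = 2q - t ≥ q`, the left side is `1 - E exp (-t) ≤ (1 - E) + E t`. Since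
`E q ≤ E a ≤ 1 - E`, this is at most `(1 - E)(1 + t/q) ≤ (1 - E) exp (t N)`. Used with `θ = exp
(-2q)` for the barrier property of `χ`. -/
theorem one_sub_exp_le {q t N : ℝ} (hq : 0 < q) (ht0 : 0 ≤ t) (ht : t ≤ q) (hN : 1 / q ≤ N) :
    1 - Real.exp (-(2 * q)) ≤ Real.exp (t * N) * (1 - Real.exp (-(2 * q)) * Real.exp t) := by
  obtain ⟨a, ha⟩ : ∃ a, a = 2 * q - t := ⟨_, rfl⟩
  have haq : q ≤ a := by linarith
  have e1 : Real.exp (-(2 * q)) * Real.exp t = Real.exp (-a) := by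
    rw [← Real.exp_add]; congr 1; rw [ha]; ring
  have e2 : Real.exp (-(2 * q)) = Real.exp (-a) * Real.exp (-t) := by
    rw [← Real.exp_add]; congr 1; rw [ha]; ring
  rw [e1, e2]
  have hE := Real.exp_pos (-a)
  have hE1 : Real.exp (-a) * (a + 1) ≤ 1 := by
    have h1 : Real.exp (-a) * Real.exp a = 1 := by rw [← Real.exp_add]; simp
    have h2 := mul_le_mul_of_nonneg_left (Real.add_one_le_exp a) hE.le
    linarith
  set E := Real.exp (-a)
  have h1 : E * (1 - t) ≤ E * Real.exp (-t) :=
    mul_le_mul_of_nonneg_left (by linarith [Real.add_one_le_exp (-t)]) hE.le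
  have htq : 0 ≤ t / q := by positivity
  have h2 : E * t ≤ (1 - E) * (t / q) := by
    have h3 : E * q ≤ 1 - E := by nlinarith
    calc E * t = (E * q) * (t / q) := by field_simp
      _ ≤ _ := by gcongr
  have h4 : 1 + t / q ≤ Real.exp (t * N) := by
    have : t / q ≤ t * N := by
      rw [div_eq_mul_one_div]; gcongr
    linarith [Real.add_one_le_exp (t * N)]
  have hE2 : 0 ≤ 1 - E := by nlinarith
  nlinarith [mul_le_mul_of_nonneg_right h4 hE2]

theorem exp_le_rpow_div_sub {S N x : ℝ} (hS : 0 ≤ S) (hx : 0 < x - N - 1) (hx0 : 0 < x) :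
    Real.exp (S / x * N) ≤ (x / (x - N - 1)) ^ S := by
  have h1 : Real.exp ((N + 1) / x) ≤ x / (x - N - 1) := by
    rw [le_div_iff₀ hx]
    have h2 : 1 - (N + 1) / x ≤ Real.exp (-((N + 1) / x)) := by
      linarith [Real.add_one_le_exp (-((N + 1) / x))]
    have h3 : x - N - 1 = x * (1 - (N + 1) / x) := by field_simp; ring
    have h4 : Real.exp ((N + 1) / x) * Real.exp (-((N + 1) / x)) = 1 := by
      rw [← Real.exp_add]; simp
    rw [h3]
    have := mul_le_mul_of_nonneg_left h2 (mul_pos (Real.exp_pos ((N + 1) / x)) hx0).le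
    nlinarith
  calc Real.exp (S / x * N) ≤ Real.exp ((N + 1) / x * S) := by
        apply Real.exp_le_exp.2
        have : (N + 1) / x * S - S / x * N = S / x := by ring
        have : 0 ≤ S / x := by positivity
        linarith
    _ = Real.exp ((N + 1) / x) ^ S := Real.exp_mul _ _
    _ ≤ _ := Real.rpow_le_rpow (Real.exp_pos _).le h1 hS

theorem rpow_succ_div_le_exp {S : ℝ} (hS : 0 ≤ S) {x : ℝ} (hx : 0 < x) :
    ((x + 1) / x) ^ S ≤ Real.exp (S / x) := by
  have h1 : (x + 1) / x ≤ Real.exp (1 / x) := by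
    have : (x + 1) / x = 1 / x + 1 := by field_simp; ring
    rw [this]
    exact Real.add_one_le_exp _
  calc ((x + 1) / x) ^ S ≤ Real.exp (1 / x) ^ S := Real.rpow_le_rpow (by positivity) h1 hS
    _ = Real.exp (S / x) := by rw [← Real.exp_mul]; congr 1; ring

/-- The sum that `χ` bounds. -/
def geomSum (θ S : ℝ) (m k : ℕ) : ℝ :=
  ∑ l ∈ Finset.range (k + 1), θ ^ (k - l) * (((m : ℝ) + k) / ((m : ℝ) + l)) ^ S

theorem geomSum_succ (θ S : ℝ) {m : ℕ} (hm : 0 < m) (k : ℕ) :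
    geomSum θ S m (k + 1) =
      θ * (((m : ℝ) + k + 1) / ((m : ℝ) + k)) ^ S * geomSum θ S m k + 1 := by
  have hm' : (0 : ℝ) < m := by exact_mod_cast hm
  unfold geomSum
  rw [Finset.sum_range_succ, Finset.mul_sum]
  congr 1
  · refine Finset.sum_congr rfl fun l hl => ?_
    have hl : l ≤ k := by simpa [Nat.lt_succ_iff] using hl
    rw [Nat.sub_add_comm hl, mul_mul_mul_comm, ← Real.mul_rpow (by positivity) (by positivity)]
    congr 1
    · ring
    · congr 1
      push_cast
      field_simp
      ring
  · have : ((m : ℝ) + (k + 1 : ℕ)) ≠ 0 := by positivity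
    rw [Nat.sub_self, pow_zero, one_mul, div_self this, Real.one_rpow]

/-- The three terms of `χ` match three regimes of `l`: below `M/2` the power is small and the ratio
crude; from there to `M - √M` the power is at most `θ^√M` and the ratio at most 2; closer to `M` the
ratio is at most the base in the third term, and the full geometric series is used. -/
theorem geomSum_le_chi_self {θ : ℝ} (h0 : 0 < θ) (h1 : θ < 1) {m M : ℕ} (hm : 6 ≤ m) (hM : m ≤ M)
    {s sL : ℝ} (hS : 0 ≤ s + sL) : geomSum θ (s + sL) m M ≤ chi θ m M s sL := by
  set S := s + sL with hSdef
  have hm' : (6 : ℝ) ≤ m := by exact_mod_cast hm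
  have hM' : (m : ℝ) ≤ M := by exact_mod_cast hM
  have hsq2 : 2 ≤ Real.sqrt M := Real.le_sqrt_of_sq_le (by linarith)
  have hsq : Real.sqrt M * Real.sqrt M = M := Real.mul_self_sqrt (by positivity)
  have hsqM : Real.sqrt M * 2 ≤ M := by nlinarith
  set N := Real.sqrt M
  have hden : 0 < (m : ℝ) + M - N - 1 := by linarith
  set c := (((m : ℝ) + M) / ((m : ℝ) + M - N - 1)) ^ S with hc
  have hc0 : 0 ≤ c := Real.rpow_nonneg (by positivity) _
  -- The last two indices are split off so that the middle range has at most `M / 2` elements for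
  -- either parity of `M`; they fall in the late regime because `√M ≥ 2`.
  have hsplit : geomSum θ S m M =
      ∑ l ∈ Finset.range (M / 2), θ ^ (M - l) * (((m : ℝ) + M) / ((m : ℝ) + l)) ^ S +
      ∑ l ∈ Finset.Ico (M / 2) (M - 1), θ ^ (M - l) * (((m : ℝ) + M) / ((m : ℝ) + l)) ^ S +
      ∑ l ∈ Finset.Ico (M - 1) (M + 1), θ ^ (M - l) * (((m : ℝ) + M) / ((m : ℝ) + l)) ^ S := by
    rw [Finset.sum_range_add_sum_Ico _ (by omega), Finset.sum_range_add_sum_Ico _ (by omega)]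
    rfl
  have hgeom : ∑ l ∈ Finset.Ico (M / 2) (M - 1), θ ^ (M - l) * c +
      ∑ l ∈ Finset.Ico (M - 1) (M + 1), θ ^ (M - l) * c ≤ 1 / (1 - θ) * c := by
    rw [Finset.sum_Ico_consecutive _ (by omega) (by omega), ← Finset.sum_mul]
    gcongr
    calc ∑ l ∈ Finset.Ico (M / 2) (M + 1), θ ^ (M - l)
        ≤ ∑ l ∈ Finset.range (M + 1), θ ^ (M - l) :=
          Finset.sum_le_sum_of_subset_of_nonneg
            (fun l hl => by simp only [Finset.mem_Ico, Finset.mem_range] at *; omega)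
            (fun _ _ _ => by positivity)
      _ = ∑ l ∈ Finset.range (M + 1), θ ^ l := by
          rw [← Finset.sum_range_reflect]
          refine Finset.sum_congr rfl fun l hl => ?_
          have : l < M + 1 := by simpa using hl
          congr 1
          omega
      _ ≤ 1 / (1 - θ) := by
          rw [one_div, ← tsum_geometric_of_lt_one h0.le h1]
          exact (summable_geometric_of_lt_one h0.le h1).sum_le_tsum _ fun _ _ => by positivity
  have hlate : ∀ l : ℕ, l ≤ M → (M : ℝ) - N ≤ l →
      θ ^ (M - l) * (((m : ℝ) + M) / ((m : ℝ) + l)) ^ S ≤ θ ^ (M - l) * c := by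
    intro l hl hl'
    rw [hc]
    gcongr
    linarith
  -- Adding both bounds avoids cutting the sum at the possibly non-integer point `M - √M`.
  have hmid : ∀ l : ℕ, M / 2 ≤ l → l ≤ M →
      θ ^ (M - l) * (((m : ℝ) + M) / ((m : ℝ) + l)) ^ S ≤ θ ^ N * 2 ^ S + θ ^ (M - l) * c := by
    intro l hl hlM
    by_cases hl' : (M : ℝ) - N ≤ l
    · have h2 : 0 ≤ θ ^ N * 2 ^ S := by positivity
      linarith [hlate l hlM hl']
    · push Not at hl'
      have h3 : (((m : ℝ) + M) / ((m : ℝ) + l)) ^ S ≤ 2 ^ S := by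
        refine Real.rpow_le_rpow (by positivity) ?_ hS
        rw [div_le_iff₀ (by positivity)]
        have : (M : ℝ) ≤ 2 * l + 1 := by exact_mod_cast (by omega : M ≤ 2 * l + 1)
        linarith
      have h4 : θ ^ (M - l) ≤ θ ^ N := by
        rw [← Real.rpow_natCast]
        refine Real.rpow_le_rpow_of_exponent_ge h0 h1.le ?_
        rw [Nat.cast_sub hlM]
        linarith
      have h5 : 0 ≤ θ ^ (M - l) * c := by positivity
      have h6 : θ ^ (M - l) * (((m : ℝ) + M) / ((m : ℝ) + l)) ^ S ≤ θ ^ N * 2 ^ S := by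
        gcongr
      linarith
  have hearly : ∀ l : ℕ, l < M / 2 →
      θ ^ (M - l) * (((m : ℝ) + M) / ((m : ℝ) + l)) ^ S ≤
        θ ^ ((M : ℝ) / 2) * (((m : ℝ) + M) / m) ^ S := by
    intro l hl
    have h4 : θ ^ (M - l) ≤ θ ^ ((M : ℝ) / 2) := by
      rw [← Real.rpow_natCast]
      refine Real.rpow_le_rpow_of_exponent_ge h0 h1.le ?_
      rw [Nat.cast_sub (by omega)]
      have : (2 : ℝ) * l ≤ M := by exact_mod_cast (by omega : 2 * l ≤ M)
      linarith
    gcongr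
    linarith [(Nat.cast_nonneg l : (0 : ℝ) ≤ l)]
  have i1 := Finset.sum_le_card_nsmul (Finset.range (M / 2)) _ _
    fun l hl => hearly l (by simpa using hl)
  have i2 := Finset.sum_le_sum (s := Finset.Ico (M / 2) (M - 1)) fun l hl =>
    hmid l (Finset.mem_Ico.1 hl).1 (by have := (Finset.mem_Ico.1 hl).2; omega)
  have i3 := Finset.sum_le_sum (s := Finset.Ico (M - 1) (M + 1)) fun l hl =>
    hlate l (by have := (Finset.mem_Ico.1 hl).2; omega) (by
      have : M ≤ l + 1 := by have := (Finset.mem_Ico.1 hl).1; omega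
      have : (M : ℝ) ≤ l + 1 := by exact_mod_cast this
      linarith)
  rw [Finset.card_range, nsmul_eq_mul] at i1
  rw [Finset.sum_add_distrib, Finset.sum_const, Nat.card_Ico, nsmul_eq_mul] at i2
  have j1 : ((M / 2 : ℕ) : ℝ) ≤ (M : ℝ) / 2 := Nat.cast_div_le
  have j2 : ((M - 1 - M / 2 : ℕ) : ℝ) ≤ (M : ℝ) / 2 := by
    rw [le_div_iff₀ (by norm_num)]
    exact_mod_cast (by omega : (M - 1 - M / 2) * 2 ≤ M)
  have k1 := mul_le_mul_of_nonneg_right j1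
    (by positivity : 0 ≤ θ ^ ((M : ℝ) / 2) * (((m : ℝ) + M) / m) ^ S)
  have k2 := mul_le_mul_of_nonneg_right j2 (by positivity : 0 ≤ θ ^ N * (2 : ℝ) ^ S)
  rw [hsplit, chi, ← hSdef]
  linarith

/-- For `k ≥ M` the sum obeys `G_{k+1} ≤ θ e^t G_k + 1` with `t = (s + s_L)/(m + M)`. A bound `χ`
persists under this step if `χ (1 - θ e^t) ≥ 1`; the third term of `χ` alone ensures that, being at
least `e^{t√M} / (1 - θ)`. -/
theorem geomSum_le_chi {θ : ℝ} (h0 : 0 < θ) (h1 : θ < 1) {m M : ℕ} (hm : 6 ≤ m) {s sL : ℝ}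
    (hS : 0 ≤ s + sL) (h : CondMA θ m M s sL) {k : ℕ} (hk : M ≤ k) :
    geomSum θ (s + sL) m k ≤ chi θ m M s sL := by
  obtain ⟨c1, c2, c3⟩ := h.of_nonneg h0 h1
  have hlog : Real.log θ < 0 := Real.log_neg h0 h1
  obtain ⟨q, hq⟩ : ∃ q, q = -(Real.log θ / 2) := ⟨_, rfl⟩
  have hq0 : 0 < q := by linarith
  have hθ : θ = Real.exp (-(2 * q)) := by
    rw [hq, show -(2 * -(Real.log θ / 2)) = Real.log θ by ring, Real.exp_log h0]
  have hm' : (6 : ℝ) ≤ m := by exact_mod_cast hm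
  have hM' : (m : ℝ) ≤ M := by exact_mod_cast c3
  have hsq : Real.sqrt M * Real.sqrt M = M := Real.mul_self_sqrt (by positivity)
  have hsq2 : 2 ≤ Real.sqrt M := Real.le_sqrt_of_sq_le (by linarith)
  have hsqM : Real.sqrt M * 2 ≤ M := by nlinarith
  have hN : 1 / q ≤ Real.sqrt M := by
    convert c2 using 1
    rw [show -Real.log θ = 2 * q by rw [hq]; ring]
    field_simp
  obtain ⟨t, ht⟩ : ∃ t, t = (s + sL) / (m + M) := ⟨_, rfl⟩
  have ht0 : 0 ≤ t := by rw [ht]; positivity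
  have htq : t ≤ q := by
    rw [ht, div_le_iff₀ (by positivity)]
    rw [← hq] at c1
    have : (s + sL) * M ≤ q * (m + M) * M := by linarith
    exact le_of_mul_le_mul_right this (by linarith)
  have key := one_sub_exp_le hq0 ht0 htq hN
  rw [← hθ] at key
  have hX : Real.exp (t * Real.sqrt M) / (1 - θ) ≤ chi θ m M s sL := by
    have h2 := exp_le_rpow_div_sub (N := Real.sqrt M) (x := (m : ℝ) + M) hS (by linarith)
      (by linarith)
    rw [← ht] at h2
    have h3 : 0 ≤ 1 / (1 - θ) := by
      have : 0 < 1 - θ := by linarith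
      positivity
    have h4 := mul_le_mul_of_nonneg_left h2 h3
    have h5 : 0 ≤ θ ^ ((M : ℝ) / 2) * ((M : ℝ) / 2) * (((m : ℝ) + M) / m) ^ (s + sL) := by positivity
    have h6 : 0 ≤ θ ^ Real.sqrt M * ((M : ℝ) / 2) * 2 ^ (s + sL) := by positivity
    unfold chi
    rw [div_eq_inv_mul, ← one_div]
    linarith
  have hX1 : 1 ≤ chi θ m M s sL * (1 - θ * Real.exp t) := by
    have h2 : 0 < 1 - θ * Real.exp t := by
      have : 0 < Real.exp (t * Real.sqrt M) * (1 - θ * Real.exp t) :=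
        lt_of_lt_of_le (by linarith) key
      exact pos_of_mul_pos_right this (Real.exp_pos _).le
    have h3 := mul_le_mul_of_nonneg_right hX h2.le
    refine le_trans ?_ h3
    rw [div_mul_eq_mul_div, one_le_div (by linarith)]
    exact key
  have hX0 : 0 ≤ chi θ m M s sL :=
    le_trans (div_nonneg (Real.exp_pos _).le (by linarith)) hX
  induction k, hk using Nat.le_induction with
  | base => exact geomSum_le_chi_self h0 h1 hm c3 hS
  | succ k hk ih =>
    rw [geomSum_succ θ _ (by omega)]
    have hk' : (M : ℝ) ≤ k := by exact_mod_cast hk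
    have hρ : (((m : ℝ) + k + 1) / ((m : ℝ) + k)) ^ (s + sL) ≤ Real.exp t := by
      refine (rpow_succ_div_le_exp hS (by positivity)).trans (Real.exp_le_exp.2 ?_)
      rw [ht]
      gcongr
    have hg : 0 ≤ geomSum θ (s + sL) m k := Finset.sum_nonneg fun _ _ => by positivity
    calc _ ≤ θ * Real.exp t * chi θ m M s sL + 1 := by gcongr
      _ ≤ _ := by linarith

/-! ### Componentwise bounds for `A` applied to a weighted residual. -/

theorem weight_add_div {s : ℝ} {m : ℕ} (hm : 0 < m) (n j : ℕ) :
    weight s (m + n) / weight s (m + j) = (((m : ℝ) + n) / ((m : ℝ) + j)) ^ s := by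
  have h1 : ∀ i, weight s (m + i) = ((m : ℝ) + i) ^ s := fun i => by
    unfold weight
    rw [if_neg (by omega)]
    push_cast
    rfl
  rw [h1, h1, Real.div_rpow (by positivity) (by positivity)]

theorem abs_mulVec_le {m : ℕ} (A : Matrix (Fin m) (Fin m) ℝ) {v C : Fin m → ℝ}
    (h : ∀ i, |v i| ≤ C i) (i : Fin m) :
    |A.mulVec v i| ≤ Matrix.mulVec (fun i j => |A i j|) C i := by
  simp only [Matrix.mulVec, dotProduct]
  refine (Finset.abs_sum_le_sum_abs _ _).trans (Finset.sum_le_sum fun j _ => ?_)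
  rw [abs_mul]
  exact mul_le_mul_of_nonneg_left (h j) (abs_nonneg _)

section Bounds

variable {lam mu bet : ℕ → ℝ} {s sL C₁ δ : ℝ} {m : ℕ}

theorem abs_wI_le (h : TailDominant lam mu bet δ m) (n : ℕ) :
    ULinvConverges lam mu bet m e₁ ∧ |wI lam mu bet m n| ≤ eta δ * theta δ ^ n / |mu m| := by
  have hg := gam_pos h.pos h.lt_half
  have hmu : 0 < |mu m| := h.mu_pos 0
  -- The majorant is concentrated at 0, so the later-index bound `b` is 0 and only the pure power
  -- `θ^n` remains.
  set B : ℕ → ℝ := fun j => if j = 0 then 1 / (gam δ * |mu m|) else 0 with hBdef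
  have hB0 : ∀ j, 0 ≤ B j := fun j => by
    simp only [hBdef]
    split_ifs
    · positivity
    · exact le_rfl
  have hB : ∀ j, |e₁ j| ≤ gam δ * |mu (m + j)| * B j := fun j => by
    rcases j with _ | j
    · simp only [hBdef, e₁, Pi.single_eq_same, if_true, add_zero]
      rw [mul_one_div_cancel (by positivity), abs_one]
    · simp [hBdef, e₁]
  refine ⟨h.uLinvConverges hB hB0 ⟨1 / (gam δ * |mu m|), fun j => ?_⟩, ?_⟩
  · simp only [hBdef]
    split_ifs
    · exact le_rfl
    · positivity
  · refine (h.abs_ULinv_le hB hB0 (k := n) (b := 0) fun j hj => ?_).trans (le_of_eq ?_)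
    · simp only [hBdef]
      rw [if_neg (by omega)]
    · rw [Finset.sum_range_succ']
      simp only [hBdef, Nat.add_eq_zero_iff, one_ne_zero, and_false, if_false, mul_zero,
        Finset.sum_const_zero, if_true, zero_mul, Nat.sub_zero, zero_add, add_zero]
      unfold eta
      rw [mul_one_div, div_mul_div_comm, div_mul_eq_mul_div, div_div]
      congr 1
      ring

theorem abs_ULinv_tail_le (h : TailDominant lam mu bet δ m) (hm : 0 < m) (hS : 0 ≤ s + sL)
    (hC₁ : 0 < C₁) (hmu : ∀ n, C₁ * weight sL (m + n) ≤ |mu (m + n)|) {κ : ℝ} (hκ : 0 ≤ κ)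
    {y : ℕ → ℝ} (hy : ∀ n, |y n| ≤ κ / weight s (m + n)) (n : ℕ) :
    ULinvConverges lam mu bet m y ∧ |ULinv lam mu bet m y n| ≤
      eta δ * κ / (C₁ * weight (s + sL) (m + n)) *
        (geomSum (theta δ) (s + sL) m n + theta δ / (1 - theta δ)) := by
  have hg := gam_pos h.pos h.lt_half
  have hw := fun k => weight_pos (s + sL) k
  -- Dividing by `|μ_{m+j}| ≥ C₁ ω^{s_L}` raises the decay exponent to `s + s_L`. This majorant is
  -- nonincreasing, so `B n` can bound all later entries.
  set B : ℕ → ℝ := fun j => κ / (gam δ * C₁ * weight (s + sL) (m + j)) with hBdef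
  have hB0 : ∀ j, 0 ≤ B j := fun j => by
    have := hw (m + j)
    positivity
  have hB : ∀ j, |y j| ≤ gam δ * |mu (m + j)| * B j := fun j => by
    have h1 := weight_pos s (m + j)
    have h2 := weight_pos sL (m + j)
    calc |y j| ≤ κ / weight s (m + j) := hy j
      _ = gam δ * (C₁ * weight sL (m + j)) * B j := by
        simp only [hBdef]
        rw [← weight_mul]
        field_simp
      _ ≤ _ := by
        gcongr
        · exact hB0 j
        · exact hmu j
  have hanti : ∀ k j, k ≤ j → B j ≤ B k := fun k j hkj => by
    have h1 := hw (m + k)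
    have h2 := weight_le_weight hS (by omega : m + k ≤ m + j)
    simp only [hBdef]
    gcongr
  refine ⟨h.uLinvConverges hB hB0 ⟨B 0, fun j => hanti 0 j (Nat.zero_le j)⟩, ?_⟩
  refine (h.abs_ULinv_le hB hB0 (k := n) fun j hj => hanti n j hj.le).trans (le_of_eq ?_)
  have e : ∑ j ∈ Finset.range (n + 1), theta δ ^ (n - j) * B j =
      B n * geomSum (theta δ) (s + sL) m n := by
    unfold geomSum
    rw [Finset.mul_sum]
    refine Finset.sum_congr rfl fun j _ => ?_
    rw [← weight_add_div hm]
    simp only [hBdef]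
    have h1 := hw (m + n)
    have h2 := hw (m + j)
    field_simp
  rw [e, ← mul_add, ← mul_assoc]
  congr 1
  simp only [hBdef]
  unfold eta
  rw [div_mul_div_comm, div_mul_eq_mul_div, div_div]
  congr 1
  ring

/-- One step multiplies the weight by at most `exp (s / (m + n))`, and `CondMY` makes this at most
`1 / θ` for `n ≥ M`. -/
theorem pow_mul_weight_le {θ : ℝ} (h0 : 0 < θ) (h1 : θ < 1) (hs : 0 ≤ s) (hm : 0 < m) {M : ℕ}
    (h : CondMY θ m M s) {n : ℕ} (hn : M ≤ n) :
    θ ^ n * weight s (m + n) ≤ θ ^ M * weight s (m + M) := by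
  have hlog : Real.log θ < 0 := Real.log_neg h0 h1
  have hm' : (0 : ℝ) < m := by exact_mod_cast hm
  have hM := (max_le_iff.1 h).1
  have hs' : s ≤ -Real.log θ * (m + M) := by
    have h2 : -s / Real.log θ ≤ (m : ℝ) + M := by linarith
    rw [div_le_iff_of_neg hlog] at h2
    linarith
  induction n, hn using Nat.le_induction with
  | base => exact le_rfl
  | succ n hn ih =>
    refine le_trans ?_ ih
    have hn' : (M : ℝ) ≤ n := by exact_mod_cast hn
    have h2 := weight_add_div (s := s) hm (n + 1) n
    have hw := weight_pos s (m + n)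
    have h3 := rpow_succ_div_le_exp hs (by positivity : (0 : ℝ) < m + n)
    have h4 : Real.exp (s / (m + n)) ≤ θ⁻¹ := by
      rw [show θ⁻¹ = (Real.exp (Real.log θ))⁻¹ by rw [Real.exp_log h0]]
      rw [← Real.exp_neg]
      refine Real.exp_le_exp.2 ?_
      rw [div_le_iff₀ (by positivity)]
      nlinarith
    rw [Nat.cast_add_one, ← add_assoc (m : ℝ)] at h2
    rw [← h2, div_le_iff₀ hw] at h3
    rw [pow_succ, mul_assoc]
    refine mul_le_mul_of_nonneg_left ?_ (by positivity)
    calc θ * weight s (m + (n + 1)) ≤ θ * (θ⁻¹ * weight s (m + n)) := by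
          refine mul_le_mul_of_nonneg_left (h3.trans ?_) h0.le
          gcongr
      _ = weight s (m + n) := by field_simp

/-- The coefficient of `θ^n` in the components of index `m + n` of `Dvec`. -/
def frontCoeff (lam mu bet : ℕ → ℝ) (s sL C₁ δ : ℝ) {m : ℕ} (hm : 0 < m)
    (Am : Matrix (Fin m) (Fin m) ℝ) (CF : Fin m → ℝ) (κ : ℝ) : ℝ :=
  (Matrix.mulVec (fun i j => |Am i j|) CF (lastIdx hm) +
    |bet (m - 1)| * |Am (lastIdx hm) (lastIdx hm)| * eta δ * κ /
      (C₁ * (1 - theta δ) * weight (s + sL) m)) * eta δ * (|lam m| / |mu m|)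

variable (lam mu bet s sL C₁ δ)

theorem Dvec_head (hm : 0 < m) (Am : Matrix (Fin m) (Fin m) ℝ) (M : ℕ) (CF : Fin m → ℝ) (κ : ℝ)
    {k : ℕ} (hk : k < m) :
    Dvec lam mu bet s sL C₁ δ hm Am M CF κ k =
      Matrix.mulVec (fun i j => |Am i j|) CF ⟨k, hk⟩ +
      |bet (m - 1)| * eta δ * κ / (C₁ * (1 - theta δ) * weight (s + sL) m) *
        |Am ⟨k, hk⟩ (lastIdx hm)| := by
  unfold Dvec
  exact dif_pos hk

theorem Dvec_mid (hm : 0 < m) (Am : Matrix (Fin m) (Fin m) ℝ) (M : ℕ) (CF : Fin m → ℝ) (κ : ℝ)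
    {n : ℕ} (hn : n < M) :
    Dvec lam mu bet s sL C₁ δ hm Am M CF κ (m + n) =
      frontCoeff lam mu bet s sL C₁ δ hm Am CF κ * theta δ ^ n +
      eta δ * κ / (C₁ * weight (s + sL) (m + n)) *
        (geomSum (theta δ) (s + sL) m n + theta δ / (1 - theta δ)) := by
  unfold Dvec
  dsimp only
  rw [dif_neg (by omega), if_pos (by omega), Nat.add_sub_cancel_left]
  push_cast
  rfl

theorem Dvec_tail (hm : 0 < m) (Am : Matrix (Fin m) (Fin m) ℝ) (M : ℕ) (CF : Fin m → ℝ) (κ : ℝ)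
    {n : ℕ} (hn : M ≤ n) :
    Dvec lam mu bet s sL C₁ δ hm Am M CF κ (m + n) =
      (frontCoeff lam mu bet s sL C₁ δ hm Am CF κ * theta δ ^ M +
      eta δ * κ / (C₁ * weight (s + sL) (m + M)) *
        (chi (theta δ) m M s sL + theta δ / (1 - theta δ))) *
      (weight s (m + M) / weight s (m + n)) := by
  unfold Dvec
  dsimp only
  rw [dif_neg (by omega), if_neg (by omega)]
  rfl

/-- Allows `A` to be estimated once, for the combined first and second order bounds, before
separating the powers of `r`. -/
theorem Dvec_linear (hm : 0 < m) (Am : Matrix (Fin m) (Fin m) ℝ) (M : ℕ) (CF CG : Fin m → ℝ)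
    (κ κ' a b : ℝ) (k : ℕ) :
    Dvec lam mu bet s sL C₁ δ hm Am M (fun i => CF i * a + CG i * b) (κ * a + κ' * b) k =
      Dvec lam mu bet s sL C₁ δ hm Am M CF κ k * a +
        Dvec lam mu bet s sL C₁ δ hm Am M CG κ' k * b := by
  have e : ∀ i, Matrix.mulVec (fun i j => |Am i j|) (fun i => CF i * a + CG i * b) i =
      Matrix.mulVec (fun i j => |Am i j|) CF i * a +
        Matrix.mulVec (fun i j => |Am i j|) CG i * b := fun i => by
    simp only [Matrix.mulVec, dotProduct]
    rw [Finset.sum_mul, Finset.sum_mul, ← Finset.sum_add_distrib]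
    exact Finset.sum_congr rfl fun j _ => by ring
  rcases lt_or_ge k m with hk | hk
  · rw [Dvec_head _ _ _ _ _ _ _ hm Am M _ _ hk, Dvec_head _ _ _ _ _ _ _ hm Am M _ _ hk,
      Dvec_head _ _ _ _ _ _ _ hm Am M _ _ hk, e]
    ring
  · obtain ⟨n, rfl⟩ := Nat.exists_eq_add_of_le hk
    rcases lt_or_ge n M with hn | hn
    · rw [Dvec_mid _ _ _ _ _ _ _ hm Am M _ _ hn, Dvec_mid _ _ _ _ _ _ _ hm Am M _ _ hn,
        Dvec_mid _ _ _ _ _ _ _ hm Am M _ _ hn, frontCoeff, frontCoeff, frontCoeff, e]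
      ring
    · rw [Dvec_tail _ _ _ _ _ _ _ hm Am M _ _ hn, Dvec_tail _ _ _ _ _ _ _ hm Am M _ _ hn,
        Dvec_tail _ _ _ _ _ _ _ hm Am M _ _ hn, frontCoeff, frontCoeff, frontCoeff, e]
      ring

variable {lam mu bet s sL C₁ δ}

theorem eta_pos (h0 : 0 < δ) (h1 : δ < 1 / 2) : 0 < eta δ := by
  have hg := gam_pos h0 h1
  have hθ := theta_pos h0 h1
  have hθ1 := theta_lt_one h0 h1
  unfold eta
  have : 0 < 1 - theta δ ^ 2 := by nlinarith
  positivity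

theorem frontCoeff_nonneg (h0 : 0 < δ) (h1 : δ < 1 / 2) (hC₁ : 0 < C₁) (hm : 0 < m)
    (Am : Matrix (Fin m) (Fin m) ℝ) {CF : Fin m → ℝ} (hCF : ∀ i, 0 ≤ CF i) {κ : ℝ} (hκ : 0 ≤ κ) :
    0 ≤ frontCoeff lam mu bet s sL C₁ δ hm Am CF κ := by
  have hη := eta_pos h0 h1
  have hθ1 : 0 < 1 - theta δ := by linarith [theta_lt_one h0 h1]
  have hw := weight_pos (s + sL) m
  have hA : 0 ≤ Matrix.mulVec (fun i j => |Am i j|) CF (lastIdx hm) := by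
    simp only [Matrix.mulVec, dotProduct]
    exact Finset.sum_nonneg fun j _ => mul_nonneg (abs_nonneg _) (hCF j)
  unfold frontCoeff
  positivity

theorem abs_ULinv_zero_le (h : TailDominant lam mu bet δ m) (hm : 0 < m) (hS : 0 ≤ s + sL)
    (hC₁ : 0 < C₁) (hmu : ∀ n, C₁ * weight sL (m + n) ≤ |mu (m + n)|) {κ : ℝ} (hκ : 0 ≤ κ)
    {y : ℕ → ℝ} (hy : ∀ n, |y n| ≤ κ / weight s (m + n)) :
    |ULinv lam mu bet m y 0| ≤ eta δ * κ / (C₁ * (1 - theta δ) * weight (s + sL) m) := by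
  refine (abs_ULinv_tail_le h hm hS hC₁ hmu hκ hy 0).2.trans (le_of_eq ?_)
  have hθ1 : 1 - theta δ ≠ 0 := by linarith [theta_lt_one h.pos h.lt_half]
  have hw := (weight_pos (s + sL) m).ne'
  have hm' : (m : ℝ) ≠ 0 := by exact_mod_cast hm.ne'
  have e : geomSum (theta δ) (s + sL) m 0 = 1 := by
    simp [geomSum, hm']
  rw [e, add_zero]
  field_simp
  ring

theorem abs_Aop_tail_le (h : TailDominant lam mu bet δ m) (hm : 0 < m) (hS : 0 ≤ s + sL)
    (hC₁ : 0 < C₁) (hmu : ∀ n, C₁ * weight sL (m + n) ≤ |mu (m + n)|)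
    (Am : Matrix (Fin m) (Fin m) ℝ) {κ : ℝ} (hκ : 0 ≤ κ) {CF : Fin m → ℝ} {v : ℕ → ℝ}
    (hF : ∀ i : Fin m, |v i| ≤ CF i) (hI : ∀ n, |v (m + n)| ≤ κ / weight s (m + n)) (n : ℕ) :
    |Aop lam mu bet hm Am v (m + n)| ≤
      frontCoeff lam mu bet s sL C₁ δ hm Am CF κ * theta δ ^ n +
      eta δ * κ / (C₁ * weight (s + sL) (m + n)) *
        (geomSum (theta δ) (s + sL) m n + theta δ / (1 - theta δ)) := by
  have hA := abs_mulVec_le Am (v := headPart m v) hF (lastIdx hm)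
  have hu0 := abs_ULinv_zero_le h hm hS hC₁ hmu hκ (y := tailPart m v) hI
  have hu := (abs_ULinv_tail_le h hm hS hC₁ hmu hκ (y := tailPart m v) hI n).2
  have hw := (abs_wI_le h n).2
  unfold Aop
  rw [dif_neg (by omega), Nat.add_sub_cancel_left]
  set a := Am.mulVec (headPart m v) (lastIdx hm)
  set A := Matrix.mulVec (fun i j => |Am i j|) CF (lastIdx hm) with hAdef
  set u0 := ULinv lam mu bet m (tailPart m v) 0
  set u := ULinv lam mu bet m (tailPart m v) n
  set w := wI lam mu bet m n
  set U := eta δ * κ / (C₁ * (1 - theta δ) * weight (s + sL) m) with hU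
  have e : frontCoeff lam mu bet s sL C₁ δ hm Am CF κ * theta δ ^ n =
      |lam m| * (A + |bet (m - 1)| * |Am (lastIdx hm) (lastIdx hm)| * U) *
        (eta δ * theta δ ^ n / |mu m|) := by
    rw [frontCoeff, ← hAdef, hU]
    ring
  have h1 : |-lam m * a * w| ≤ |lam m| * A * (eta δ * theta δ ^ n / |mu m|) := by
    rw [abs_mul, abs_mul, abs_neg]
    have hA0 : 0 ≤ A := (abs_nonneg _).trans hA
    gcongr
  have h2 : |bet (m - 1) * lam m * Am (lastIdx hm) (lastIdx hm) * u0 * w| ≤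
      |bet (m - 1)| * |lam m| * |Am (lastIdx hm) (lastIdx hm)| * U *
        (eta δ * theta δ ^ n / |mu m|) := by
    rw [abs_mul, abs_mul, abs_mul, abs_mul]
    have hU0 : 0 ≤ U := (abs_nonneg _).trans hu0
    gcongr
  have h3 := abs_add_le (-lam m * a * w)
    (u + bet (m - 1) * lam m * Am (lastIdx hm) (lastIdx hm) * u0 * w)
  have h4 := abs_add_le u (bet (m - 1) * lam m * Am (lastIdx hm) (lastIdx hm) * u0 * w)
  rw [e]
  linarith

theorem abs_Aop_le_Dvec (h : TailDominant lam mu bet δ m) (hm : 0 < m) (hm6 : 6 ≤ m) (hs : 0 ≤ s)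
    (hsL : 0 ≤ sL) (hC₁ : 0 < C₁) (hmu : ∀ n, C₁ * weight sL (m + n) ≤ |mu (m + n)|)
    (Am : Matrix (Fin m) (Fin m) ℝ) {M : ℕ} (hMA : CondMA (theta δ) m M s sL)
    (hMY : CondMY (theta δ) m M s) {κ : ℝ} (hκ : 0 ≤ κ) {CF : Fin m → ℝ} {v : ℕ → ℝ}
    (hF : ∀ i : Fin m, |v i| ≤ CF i) (hI : ∀ n, |v (m + n)| ≤ κ / weight s (m + n)) (k : ℕ) :
    |Aop lam mu bet hm Am v k| ≤ Dvec lam mu bet s sL C₁ δ hm Am M CF κ k := by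
  have hS : 0 ≤ s + sL := by linarith
  have hθ := theta_pos h.pos h.lt_half
  have hθ1 := theta_lt_one h.pos h.lt_half
  rcases lt_or_ge k m with hk | hk
  · rw [Dvec_head _ _ _ _ _ _ _ hm Am M _ _ hk, Aop, dif_pos hk]
    have hA := abs_mulVec_le Am (v := headPart m v) hF ⟨k, hk⟩
    have hu0 := abs_ULinv_zero_le h hm hS hC₁ hmu hκ (y := tailPart m v) hI
    refine (abs_sub _ _).trans (add_le_add hA ?_)
    rw [abs_mul, abs_mul, mul_assoc |bet (m - 1)| (eta δ), mul_div_assoc]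
    gcongr
  · obtain ⟨n, rfl⟩ := Nat.exists_eq_add_of_le hk
    have ht := abs_Aop_tail_le h hm hS hC₁ hmu Am hκ hF hI n
    rcases lt_or_ge n M with hn | hn
    · rwa [Dvec_mid _ _ _ _ _ _ _ hm Am M _ _ hn]
    · rw [Dvec_tail _ _ _ _ _ _ _ hm Am M _ _ hn]
      refine ht.trans ?_
      have hη := eta_pos h.pos h.lt_half
      have hfront := frontCoeff_nonneg (lam := lam) (mu := mu) (bet := bet) (s := s) (sL := sL)
        h.pos h.lt_half hC₁ hm Am (fun i => (abs_nonneg _).trans (hF i)) hκ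
      have hg := geomSum_le_chi hθ hθ1 hm6 hS hMA hn
      have hg0 : 0 ≤ geomSum (theta δ) (s + sL) m n :=
        Finset.sum_nonneg fun _ _ => by positivity
      have hq : 0 ≤ theta δ / (1 - theta δ) := div_nonneg hθ.le (by linarith)
      have hw1 := weight_pos s (m + n)
      have hw2 := weight_pos s (m + M)
      have hw3 := weight_pos sL (m + n)
      have hw4 := weight_pos sL (m + M)
      have hw6 := weight_pos (s + sL) (m + M)
      have hw5 := weight_le_weight hsL (by omega : m + M ≤ m + n)
      have hpow := pow_mul_weight_le hθ hθ1 hs hm hMY hn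
      have h1 : theta δ ^ n ≤ theta δ ^ M * (weight s (m + M) / weight s (m + n)) := by
        rw [← mul_div_assoc, le_div_iff₀ hw1]
        exact hpow
      -- Only the surplus decay `ω^{s_L}` is frozen at `m + M`; the factor `ω^s` is retained to
      -- match the tail of `Dvec`.
      have h2 : eta δ * κ / (C₁ * weight (s + sL) (m + n)) ≤
          eta δ * κ / (C₁ * weight (s + sL) (m + M)) * (weight s (m + M) / weight s (m + n)) := by
        have : eta δ * κ / (C₁ * weight (s + sL) (m + M)) * (weight s (m + M) / weight s (m + n)) =
            eta δ * κ / (C₁ * (weight s (m + n) * weight sL (m + M))) := by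
          rw [← weight_mul]
          field_simp
        rw [this, ← weight_mul]
        gcongr
      have h3 := mul_le_mul_of_nonneg_left h1 hfront
      have h4 := mul_le_mul h2 (add_le_add hg (le_refl (theta δ / (1 - theta δ))))
        (by positivity) (by positivity)
      refine (add_le_add h3 h4).trans (le_of_eq ?_)
      ring

end Bounds

end TridiagNewton
end

/-! ### The bound `Z²(r)`. -/

theorem mainTheorem6
    {lam mu bet : ℕ → ℝ} {sL C₁ C₂ δ : ℝ} {k₀ : ℕ}
    (hT : TridiagAssumptions lam mu bet sL C₁ C₂ δ k₀)
    {s : ℝ} (hs1 : 1 < s) (hs : 2 ≤ s) (σ : ℝ) (g : Omega s)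
    {m : ℕ} (hm0 : 0 < m) (hm : 6 ≤ m) (hmk : k₀ ≤ m)
    (xbar : Fin m → ℝ) (Am : Matrix (Fin m) (Fin m) ℝ)
    (L M : ℕ) (hL : 1 ≤ L)
    (hMA : CondMA (theta δ) m M s sL) (hMY : CondMY (theta δ) m M s)
    (r : ℝ) (y z : Omega s) (hy : ‖y‖ ≤ r) (hz : ‖z‖ ≤ r) :
    let f : Omega s → Omega (s - sL) := fMap hT hs1 σ g
    let D : Matrix (Fin m) (Fin m) ℝ := galerkinJacobian f m xbar
    let v : ℕ → ℝ := fun k =>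
      (fderiv ℝ f (embed s xbar + y) z) k - Adagger lam mu bet m D z k
    DifferentiableAt ℝ (galerkin f m) xbar ∧
    DifferentiableAt ℝ f (embed s xbar + y) ∧
    ULinvConverges lam mu bet m e₁ ∧
    ULinvConverges lam mu bet m (tailPart m v) ∧
    ∀ k, |Aop lam mu bet hm0 Am v k| ≤ Z2 lam mu bet s sL C₁ δ σ L hm0 Am M xbar r k := by
  intro f D v
  have hdom := hT.tailDominant hmk
  have hr : 0 ≤ r := (norm_nonneg y).trans hy
  have hα : 0 ≤ alpha s L m m :=
    (convFinite_add_nonneg hs1 L m).trans (convFinite_add_le_alpha hs L hm le_rfl)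
  have hmu : ∀ n, C₁ * weight sL (m + n) ≤ |mu (m + n)| := fun n => by
    have h := hT.le_mu (m + n) (by omega)
    rwa [abs_div, abs_of_pos (weight_pos _ _), le_div_iff₀ (weight_pos _ _)] at h
  have hyz : ‖y‖ * ‖z‖ ≤ r ^ 2 := by
    rw [sq]
    exact mul_le_mul hy hz (norm_nonneg _) hr
  -- The combination `κ¹ r + κ² r²`, shaped so that `Dvec_linear` applies verbatim at the end.
  set κ : ℝ := 2 * |σ| * alpha s L m m * ‖embed s xbar‖ * r + 2 * |σ| * alpha s L m m * r ^ 2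
    with hκdef
  have hκ : 0 ≤ κ := by positivity
  have hF : ∀ i : Fin m, |v i| ≤ C1head s σ xbar i * r + C2head s σ L m i * r ^ 2 := by
    intro i
    have e : v i = 2 * σ * conv (extendZero xbar) (dropHead m z) i + 2 * σ * conv y z i :=
      residual_head hT hs1 σ g xbar y z i.2
    have hw := weight_pos s i
    have h1 := abs_conv_dropHead_le hs1 xbar z i.2
    have h2 := abs_conv_le_head hs1 hL y z i.2
    have hα0 : 0 ≤ alpha s L m i := by
      rw [← convFinite_add_eq_alpha s L i.2]
      exact convFinite_add_nonneg hs1 L i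
    set S := ∑ l ∈ Finset.Icc (m - (i : ℕ)) (m - 1), |extendZero xbar l| / weight s (i + l)
      with hSdef
    have hS0 : 0 ≤ S := Finset.sum_nonneg fun l _ => div_nonneg (abs_nonneg _) (weight_pos _ _).le
    -- The separate value at index 0 agrees with the general formula, whose range from `m` to `m -
    -- 1` is empty.
    have e1 : C1head s σ xbar i = 2 * |σ| * S := by
      unfold C1head
      split_ifs with h0
      · rw [hSdef, h0, Finset.Icc_eq_empty (by omega), Finset.sum_empty, mul_zero]
      · rfl
    rw [e, e1, C2head]
    refine (abs_add_le _ _).trans (add_le_add ?_ ?_)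
    · rw [abs_mul, abs_mul, abs_two, mul_assoc (2 * |σ|)]
      gcongr
      exact h1.trans (by gcongr)
    · rw [abs_mul, abs_mul, abs_two]
      calc 2 * |σ| * |conv y z i| ≤ 2 * |σ| * (alpha s L m i * ‖y‖ * ‖z‖ / weight s i) := by gcongr
        _ = 2 * |σ| * alpha s L m i / weight s i * (‖y‖ * ‖z‖) := by ring
        _ ≤ _ := by gcongr
  have hI : ∀ n, |v (m + n)| ≤ κ / weight s (m + n) := by
    intro n
    have e : v (m + n) = 2 * σ * conv (embed s xbar) z (m + n) + 2 * σ * conv y z (m + n) :=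
      residual_tail hT hs1 σ g xbar y z (by omega)
    have hw := weight_pos s (m + n)
    have h1 := abs_conv_le_tail hs hL (embed s xbar) z hm (by omega : m ≤ m + n)
    have h2 := abs_conv_le_tail hs hL y z hm (by omega : m ≤ m + n)
    rw [e, hκdef, add_div]
    refine (abs_add_le _ _).trans (add_le_add ?_ ?_)
    · rw [abs_mul, abs_mul, abs_two]
      calc 2 * |σ| * |conv (embed s xbar) z (m + n)|
          ≤ 2 * |σ| * (alpha s L m m * ‖embed s xbar‖ * ‖z‖ / weight s (m + n)) := by gcongr
        _ = 2 * |σ| * alpha s L m m * ‖embed s xbar‖ * ‖z‖ / weight s (m + n) := by ring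
        _ ≤ _ := by gcongr
    · rw [abs_mul, abs_mul, abs_two]
      calc 2 * |σ| * |conv y z (m + n)|
          ≤ 2 * |σ| * (alpha s L m m * ‖y‖ * ‖z‖ / weight s (m + n)) := by gcongr
        _ = 2 * |σ| * alpha s L m m * (‖y‖ * ‖z‖) / weight s (m + n) := by ring
        _ ≤ _ := by gcongr
  have hsL := hT.sL_pos
  refine ⟨(hasFDerivAt_galerkin hT hs1 σ g m xbar).differentiableAt,
    (hasFDerivAt_fMap hT hs1 σ g _).differentiableAt, (abs_wI_le hdom 0).1,
    (abs_ULinv_tail_le hdom hm0 (by linarith) hT.C₁_pos hmu hκ (y := tailPart m v) hI 0).1,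
    fun k => ?_⟩
  have h := abs_Aop_le_Dvec hdom hm0 hm (by linarith) hsL.le hT.C₁_pos hmu Am hMA hMY hκ hF hI k
  rw [hκdef, Dvec_linear] at h
  exact h
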